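/- Let $0<\beta_L\le\beta_R$, $T_L=1/\beta_L$, $T_R=1/\beta_R$, and consider a particle in $[0,1]$ moving freely between two thermal walls, at $0$ (left) and $1$ (right). Its initial position and velocity are $q_0\in[0,1]$ and $p_0\neq 0$. Put $\sigma_0=\operatorname{sign}(p_0)$ and $\sigma_k=(-1)^k\sigma_0$; the first collision occurs at time $S_0=\big(\tfrac{\sigma_0+1}{2}-q_0\big)/p_0$ and the later ones at times $S_k=S_0+\tau_1+\dots+\tau_k$, $k\ge 1$, where $\tau_1,\tau_2,\dots$ are independent and $1/\tau_k$ has the law $\beta\,p\,e^{-\beta p^2/2}\mathbf 1_{\{p>0\}}\,dp$ with $\beta=\beta_L$ if $\sigma_{k-1}=-1$ and $\beta=\beta_R$ if $\sigma_{k-1}=1$. With $v_k=\sigma_k/\tau_k$, the energy exchanged between the walls during $[0,t]$ is $$J[0,t]=\frac12\sum_{k\ge 1:\,S_k\le t}v_k^2\,\sigma_k .$$ For $\lambda\in\mathbb R$ let $$f(\lambda)=\lim_{t\to+\infty}\frac1t\log\mathbb E\big(e^{\lambda J[0,t]}\big)\in[-\infty,+\infty],\qquad I(j)=\sup_{\lambda\in\mathbb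 R}\{\lambda j-f(\lambda)\},\quad j\in\mathbb R,$$ and let $j^*=\kappa(T_L-T_R)$ with $\kappa^{-1}=\sqrt{\pi\beta_L/2}+\sqrt{\pi\beta_R/2}$. Then the limit $f(\lambda)$ exists for every $\lambda\in\mathbb R$ and does not depend on $(q_0,p_0)$, and the function $I$ is finite, nonnegative and convex on $\mathbb R$. Moreover: 1. $I$ is $C^\infty$ on $\mathbb R\setminus[-j^*,j^*]$ and strictly convex there: $I(ax+by)<aI(x)+bI(y)$ for all distinct $x,y\in\mathbb R\setminus[-j^*,j^*]$ and all $a,b>0$ with $a+b=1$; 2. $I(j)=0$ for all $j\in[0,j^*]$; 3. $I(j)=(\beta_R-\beta_L)|j|$ for all $j\in[-j^*,0]$; 4. $I(j)=(\beta_L-\beta_R)\,j+I(-j)$ for all $j\in\mathbb R$. -/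

import Mathlib

open MeasureTheory Filter Topology

namespace ConfinedTracer

noncomputable section

/-- Density on `ℝ` of the law `φ_β(dp) = β p e^{-β p²/2} 1_{p>0} dp` of the speed with which a wall
of inverse temperature `β` re-emits the particle. -/
def wallDensity (β p : ℝ) : ℝ :=
  if 0 < p then β * p * Real.exp (-β * p ^ 2 / 2) else 0

/-- The law `φ_β` of the speed at emission from a wall of inverse temperature `β`. -/
def wallLaw (β : ℝ) : Measure ℝ :=
  volume.withDensity fun p => ENNReal.ofReal (wallDensity β p)

/-- The sign `σ_k = (-1)^k σ_0`, with `σ_0 = sign p₀`: the particle sits at the right wall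
(`σ_k = 1`) or at the left wall (`σ_k = -1`) at its `k`-th collision, collisions being numbered
from `k = 0`. -/
def wallSign (p₀ : ℝ) (k : ℕ) : ℝ := (-1) ^ k * Real.sign p₀

/-- Inverse temperature `β_σ` of the wall `σ`, with `β_{-1} = β_L` and `β_{1} = β_R`. -/
def wallBeta (βL βR σ : ℝ) : ℝ := if σ < 0 then βL else βR

/-- Law of the sequence of emission speeds: the speed `u k = 1 / τ_{k+1}` with which the particle
leaves the wall after its `k`-th collision has law `φ_{β_{σ_k}}`, and these speeds are
independent. -/
def speedLaw (βL βR p₀ : ℝ) : Measure (ℕ → ℝ) :=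
  Measure.infinitePi fun k => wallLaw (wallBeta βL βR (wallSign p₀ k))

/-- The time `S_k = S_0 + τ_1 + ⋯ + τ_k` of the `k`-th collision (`k ≥ 0`), where
`S_0 = (σ̂_0 - q₀) / p₀` with `σ̂_0 = (σ_0 + 1) / 2`, and `τ_{i+1} = 1 / u i` is the time needed
to cross `[0,1]` at speed `u i`. -/
def collisionTime (q₀ p₀ : ℝ) (u : ℕ → ℝ) (k : ℕ) : ℝ :=
  ((Real.sign p₀ + 1) / 2 - q₀) / p₀ + ∑ i ∈ Finset.range k, 1 / u i

open scoped Classical in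
/-- The energy `J[0,t] = (1/2) ∑_{k ≥ 1, S_k ≤ t} v_k² σ_k` exchanged between the walls during
`[0,t]`, where `v_k = σ_k / τ_k = σ_k * u (k-1)` is the velocity just before the `k`-th collision.
Almost surely the sum has finitely many nonzero terms. The index `n` below is `k - 1`. -/
def current (q₀ p₀ : ℝ) (u : ℕ → ℝ) (t : ℝ) : ℝ :=
  (1 / 2) * ∑' n : ℕ, if collisionTime q₀ p₀ u (n + 1) ≤ t then
    (wallSign p₀ (n + 1) * u n) ^ 2 * wallSign p₀ (n + 1) else 0

/-- `(1/t) log E(exp(λ J[0,t]))`, an extended real number. -/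
def scaledLogMgf (βL βR q₀ p₀ l t : ℝ) : EReal :=
  ((1 / t : ℝ) : EReal) * ENNReal.log
    (∫⁻ u, ENNReal.ofReal (Real.exp (l * current q₀ p₀ u t)) ∂(speedLaw βL βR p₀))

/-- The cumulant generating function `f(λ) = lim_{t → ∞} (1/t) log E(exp(λ J[0,t]))`, with values
in the extended reals. It is written as an upper limit, which is defined without further ado. -/
def cgf (βL βR q₀ p₀ l : ℝ) : EReal :=
  limsup (scaledLogMgf βL βR q₀ p₀ l) atTop

/-- The Legendre transform `I(j) = sup_{λ ∈ ℝ} (λ j - f(λ))`. -/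
def rateFunction (βL βR q₀ p₀ j : ℝ) : EReal :=
  ⨆ l : ℝ, (((l * j : ℝ) : EReal) - cgf βL βR q₀ p₀ l)

/-- The conductivity `κ`, given by `κ⁻¹ = (π β_L / 2)^{1/2} + (π β_R / 2)^{1/2}`. -/
def conductivity (βL βR : ℝ) : ℝ :=
  (Real.sqrt (Real.pi * βL / 2) + Real.sqrt (Real.pi * βR / 2))⁻¹

/-- `j* = κ (T_L - T_R)`, with `T_L = 1/β_L` and `T_R = 1/β_R`. -/
def jStar (βL βR : ℝ) : ℝ := conductivity βL βR * (1 / βL - 1 / βR)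

theorem isProbabilityMeasure_wallLaw {β : ℝ} (hβ : 0 < β) : IsProbabilityMeasure (wallLaw β) := by
  have hb : 0 < β / 2 := by positivity
  have e : wallDensity β = Set.indicator (Set.Ioi 0)
      (fun p => β * (p * Real.exp (-(β / 2) * p ^ 2))) := by
    funext p
    by_cases hp : 0 < p
    · have h : -β * p ^ 2 / 2 = -(β / 2) * p ^ 2 := by ring
      rw [Set.indicator_of_mem (Set.mem_Ioi.2 hp), wallDensity, if_pos hp, h]
      ring
    · rw [Set.indicator_of_notMem (by simpa using hp), wallDensity, if_neg hp]
  have hi : Integrable (wallDensity β) := by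
    rw [e]
    exact ((integrable_mul_exp_neg_mul_sq hb).const_mul β).indicator measurableSet_Ioi
  have h0 : 0 ≤ᵐ[volume] wallDensity β := by
    refine Filter.Eventually.of_forall fun p => ?_
    show 0 ≤ wallDensity β p
    unfold wallDensity
    split_ifs <;> positivity
  have hint : ∫ p, wallDensity β p = 1 := by
    rw [e, integral_indicator measurableSet_Ioi, integral_const_mul]
    have h := integral_rpow_mul_exp_neg_mul_rpow (p := 2) (q := 1) (b := β / 2)
      (by norm_num) (by norm_num) hb
    have h' : ∫ x in Set.Ioi (0 : ℝ), x * Real.exp (-(β / 2) * x ^ 2) =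
        ∫ x in Set.Ioi (0 : ℝ), x ^ (1 : ℝ) * Real.exp (-(β / 2) * x ^ (2 : ℝ)) := by
      refine setIntegral_congr_fun measurableSet_Ioi fun x _ => ?_
      simp only [Real.rpow_one, Real.rpow_two]
    rw [h', h]
    norm_num
    rw [Real.rpow_neg_one]
    field_simp
  refine ⟨?_⟩
  rw [wallLaw, withDensity_apply _ MeasurableSet.univ, Measure.restrict_univ,
    ← ofReal_integral_eq_lintegral_ofReal hi h0, hint, ENNReal.ofReal_one]

end

end ConfinedTracer

/-! A cycle is one flight out of each wall; let `ΔJ` be the energy it exchanges and `Δt` its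
duration. By independence `E e^{λ ΔJ - θ Δt}` is the product of two integrals `∫ p e^{-b p²/2 -
θ/p}`, with `b = β_L - λ` and `b = β_R + λ`. Everything is read off the planar region `K = {(λ, θ) :
E e^{λ ΔJ - θ Δt} ≤ 1}` (`epigraph`).

Probability. The motion renews itself at each collision. If the transform at `(λ, θ)` is below 1, a
Chernoff sum bounds `E e^{λ J[0,t]}` by `C e^{θ t}` (`exists_partition_le`); if it is above 1, the
renewal inequality, iterated over flights of bounded duration, bounds it below by `c e^{θ t}`
(`exists_le_partition`). The transform is strictly decreasing in `θ` where finite, so `f(λ) = inf {θ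
: (λ, θ) ∈ K}`, and `I` is the support function `rate` of `K` (`rateFunction_eq_rate`).

Geometry. Slow particles give flights a polynomial tail, so the transform is infinite for `θ < 0`
and `K` lies in `θ ≥ 0`. Jensen's inequality at the origin puts `K` above the line `θ = j* λ` as
well. These two lines meet at `(0, 0) ∈ K`, and this corner is the zero set `[0, j*]` of `I`. The
reflection `λ ↦ β_L - β_R - λ` exchanges the two factors and preserves `K`: this is the fluctuation
symmetry 4, from which 3 follows. For `j > j*` the maximiser of `λ j - θ` has `θ > 0` and lies on
the smooth curve where the transform equals 1. There the slope of the curve is `j`, and strict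
Cauchy–Schwarz makes the slope vary strictly along the curve. The inverse function theorem then
gives smoothness of `I`; that a boundary point has only one slope gives strict convexity. -/

namespace ConfinedTracer

noncomputable section

/-! ### Moments of the exponential family `p e^{-b p²/2 - θ/p}` -/

/-- The moment `∫_{p>0} p^a e^{-b p²/2 - θ/p} dp`. -/
def moment (a : ℤ) (b θ : ℝ) : ℝ :=
  ∫ p in Set.Ioi (0 : ℝ), p ^ a * Real.exp (-b * p ^ 2 / 2 - θ / p)

/-- The integral `∫_{p>0} p e^{-b p²/2 - θ/p} dp`, with values in `[0, ∞]`. -/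
def mass (b θ : ℝ) : ENNReal :=
  ∫⁻ p in Set.Ioi (0 : ℝ), ENNReal.ofReal (p * Real.exp (-b * p ^ 2 / 2 - θ / p))

theorem measurable_momentKernel (a : ℤ) (b θ : ℝ) :
    Measurable fun p : ℝ => p ^ a * Real.exp (-b * p ^ 2 / 2 - θ / p) := by
  have : Measurable fun p : ℝ => p ^ a := by
    cases a with
    | ofNat n => simpa using (measurable_id (α := ℝ)).pow_const n
    | negSucc n =>
      simp only [zpow_negSucc]
      exact ((measurable_id (α := ℝ)).pow_const (n + 1)).inv
  fun_prop

theorem integrableOn_momentKernel_of_nonneg (n : ℕ) {b θ : ℝ} (hb : 0 < b) (hθ : 0 ≤ θ) :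
    IntegrableOn (fun p : ℝ => p ^ (n : ℤ) * Real.exp (-b * p ^ 2 / 2 - θ / p)) (Set.Ioi 0) := by
  have h := integrableOn_rpow_mul_exp_neg_mul_sq (half_pos hb)
    (show (-1 : ℝ) < n from by have : (0 : ℝ) ≤ n := n.cast_nonneg
                               linarith)
  refine h.mono' (measurable_momentKernel n b θ).aestronglyMeasurable ?_
  refine (ae_restrict_iff' measurableSet_Ioi).2 (Eventually.of_forall fun p hp => ?_)
  have hp : 0 < p := hp
  have : 0 ≤ θ / p := by positivity
  rw [Real.norm_of_nonneg (by positivity), zpow_natCast, Real.rpow_natCast]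
  gcongr
  linarith

/-- For `θ > 0` the factor `e^{-θ/p}` absorbs any negative power at the origin, since `(θ/p)^n / n!
≤ e^{θ/p}`. -/
theorem integrableOn_momentKernel (a : ℤ) {b θ : ℝ} (hb : 0 < b) (hθ : 0 < θ) :
    IntegrableOn (fun p : ℝ => p ^ a * Real.exp (-b * p ^ 2 / 2 - θ / p)) (Set.Ioi 0) := by
  rcases a.eq_nat_or_neg with ⟨n, rfl | rfl⟩
  · exact integrableOn_momentKernel_of_nonneg n hb hθ.le
  · have h := (integrableOn_momentKernel_of_nonneg 0 hb le_rfl).const_mul (n.factorial / θ ^ n)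
    refine h.mono' (measurable_momentKernel _ b θ).aestronglyMeasurable ?_
    refine (ae_restrict_iff' measurableSet_Ioi).2 (Eventually.of_forall fun p hp => ?_)
    have hp : 0 < p := hp
    have h1 : (θ / p) ^ n / n.factorial ≤ Real.exp (θ / p) :=
      Real.pow_div_factorial_le_exp _ (by positivity) n
    have h2 : p ^ (-(n : ℤ)) * Real.exp (-(θ / p)) ≤ n.factorial / θ ^ n := by
      rw [zpow_neg, zpow_natCast, Real.exp_neg, ← mul_inv, le_div_iff₀ (by positivity),
        inv_mul_le_iff₀ (by positivity)]
      rw [div_pow, div_div, div_le_iff₀ (by positivity)] at h1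
      linarith
    rw [Real.norm_of_nonneg (by positivity), sub_eq_add_neg, Real.exp_add,
      mul_comm (Real.exp _), ← mul_assoc]
    simp only [Nat.cast_zero, zpow_zero, one_mul, zero_div, sub_zero]
    gcongr

theorem moment_eq_rpow_integral (n : ℕ) (b : ℝ) : moment n b 0 =
    ∫ x in Set.Ioi (0 : ℝ), x ^ (n : ℝ) * Real.exp (-(b / 2) * x ^ (2 : ℝ)) := by
  refine setIntegral_congr_fun measurableSet_Ioi fun x _ => ?_
  simp only [Real.rpow_natCast, Real.rpow_two, zpow_natCast, zero_div, sub_zero]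
  ring_nf

theorem moment_one_zero {b : ℝ} (hb : 0 < b) : moment 1 b 0 = 1 / b := by
  have h := integral_rpow_mul_exp_neg_mul_rpow (p := 2) (q := (1 : ℕ)) (b := b / 2)
      (by norm_num) (by norm_num) (half_pos hb)
  rw [← moment_eq_rpow_integral] at h
  push_cast at h
  rw [h]
  norm_num
  rw [Real.rpow_neg_one]
  field_simp

theorem moment_three_zero {b : ℝ} (hb : 0 < b) : moment 3 b 0 = 2 / b ^ 2 := by
  have h := integral_rpow_mul_exp_neg_mul_rpow (p := 2) (q := (3 : ℕ)) (b := b / 2)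
      (by norm_num) (by norm_num) (half_pos hb)
  rw [← moment_eq_rpow_integral] at h
  push_cast at h
  rw [h]
  norm_num
  field_simp

theorem moment_zero_zero {b : ℝ} (hb : 0 < b) : b * moment 0 b 0 = √(Real.pi * b / 2) := by
  have h := integral_gaussian_Ioi (b / 2)
  have e : moment 0 b 0 = ∫ x in Set.Ioi (0 : ℝ), Real.exp (-(b / 2) * x ^ 2) := by
    refine setIntegral_congr_fun measurableSet_Ioi fun x _ => ?_
    simp only [zpow_zero, zero_div, sub_zero]
    ring_nf
  rw [e, h]
  symm
  rw [Real.sqrt_eq_iff_mul_self_eq (by positivity) (by positivity)]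
  have := Real.mul_self_sqrt (show 0 ≤ Real.pi / (b / 2) by positivity)
  symm
  calc b * (√(Real.pi / (b / 2)) / 2) * (b * (√(Real.pi / (b / 2)) / 2))
      = b ^ 2 / 4 * (√(Real.pi / (b / 2)) * √(Real.pi / (b / 2))) := by ring
    _ = _ := by rw [this]; field_simp; norm_num

theorem moment_one_pos {b θ : ℝ} (hb : 0 < b) (hθ : 0 ≤ θ) : 0 < moment 1 b θ := by
  have hi := integrableOn_momentKernel_of_nonneg 1 hb hθ
  refine (setIntegral_pos_iff_support_of_nonneg_ae ?_ hi).2 ?_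
  · refine (ae_restrict_iff' measurableSet_Ioi).2 (Eventually.of_forall fun p hp => ?_)
    have hp : 0 < p := hp
    show 0 ≤ _
    positivity
  · have : Set.Ioi (0 : ℝ) ⊆ (Function.support fun p : ℝ =>
        p ^ ((1 : ℕ) : ℤ) * Real.exp (-b * p ^ 2 / 2 - θ / p)) ∩ Set.Ioi 0 := by
      intro p hp
      have hp' : 0 < p := hp
      exact ⟨by simp only [Function.mem_support]; positivity, hp⟩
    refine lt_of_lt_of_le ?_ (measure_mono this)
    simp

theorem mass_eq_ofReal {b θ : ℝ} (hb : 0 < b) (hθ : 0 ≤ θ) :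
    mass b θ = ENNReal.ofReal (moment 1 b θ) := by
  have hi := integrableOn_momentKernel_of_nonneg 1 hb hθ
  rw [moment]
  simp only [Nat.cast_one] at hi
  rw [ofReal_integral_eq_lintegral_ofReal hi]
  · simp [mass]
  · refine (ae_restrict_iff' measurableSet_Ioi).2 (Eventually.of_forall fun p hp => ?_)
    have hp : 0 < p := hp
    show 0 ≤ _
    positivity

theorem mass_eq_top_of_nonpos {b : ℝ} (hb : b ≤ 0) (θ : ℝ) : mass b θ = ⊤ := by
  have h : ∫⁻ p in Set.Ioi (1 : ℝ), ENNReal.ofReal (Real.exp (-|θ|)) = ⊤ := by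
    rw [setLIntegral_const, Real.volume_Ioi, ENNReal.mul_top]
    simpa using Real.exp_pos _
  refine top_le_iff.1 (h ▸ ?_)
  refine le_trans (setLIntegral_mono' measurableSet_Ioi fun p hp => ?_)
    (lintegral_mono_set (Set.Ioi_subset_Ioi zero_le_one))
  have hp : 1 < p := hp
  have h1 : θ / p ≤ |θ| := by
    rw [div_le_iff₀ (by linarith)]
    nlinarith [abs_nonneg θ, le_abs_self θ]
  have h2 : 0 ≤ -b * p ^ 2 / 2 := by
    have : 0 ≤ -b := by linarith
    positivity
  refine ENNReal.ofReal_le_ofReal ?_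
  have h3 : Real.exp (-|θ|) ≤ Real.exp (-b * p ^ 2 / 2 - θ / p) := Real.exp_le_exp.2 (by linarith)
  nlinarith [Real.exp_pos (-|θ|)]

/-- Near `p = 0`, `e^{|θ|/p} ≥ (θ/p)²/2`, so the integrand dominates a multiple of `1/p`. This
divergence, due to slow particles, confines the region to `θ ≥ 0` and is responsible for the flat
part of the rate function. -/
theorem mass_eq_top_of_neg (b : ℝ) {θ : ℝ} (hθ : θ < 0) : mass b θ = ⊤ := by
  by_contra h
  set c := Real.exp (-|b| / 2) * (θ ^ 2 / 2) with hc
  have hc0 : 0 < c := by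
    have : 0 < θ ^ 2 := by nlinarith
    positivity
  have hint : IntegrableOn (fun x : ℝ => c * x ^ (-1 : ℝ)) (Set.Ioo 0 1) := by
    refine ⟨by fun_prop, ?_⟩
    refine lt_of_le_of_lt ?_ (lt_top_iff_ne_top.2 h)
    refine le_trans (setLIntegral_mono' measurableSet_Ioo fun p hp => ?_)
      (lintegral_mono_set Set.Ioo_subset_Ioi_self)
    obtain ⟨hp0, hp1⟩ := hp
    simp only [Real.rpow_neg_one]
    rw [← ofReal_norm, Real.norm_of_nonneg (by positivity)]
    refine ENNReal.ofReal_le_ofReal ?_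
    have h1 : (-θ / p) ^ 2 / 2 ≤ Real.exp (-θ / p) := by
      have := Real.pow_div_factorial_le_exp (-θ / p)
        (div_nonneg (by linarith) hp0.le) 2
      simpa using this
    have h2 : Real.exp (-|b| / 2) ≤ Real.exp (-b * p ^ 2 / 2) := by
      refine Real.exp_le_exp.2 ?_
      have : b * p ^ 2 ≤ |b| := by
        have : p ^ 2 ≤ 1 := by nlinarith
        nlinarith [abs_nonneg b, le_abs_self b, sq_nonneg p]
      linarith
    calc c * p⁻¹ = p * (Real.exp (-|b| / 2) * ((-θ / p) ^ 2 / 2)) := by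
          rw [hc]; field_simp
      _ ≤ p * (Real.exp (-b * p ^ 2 / 2) * Real.exp (-θ / p)) := by gcongr
      _ = _ := by rw [← Real.exp_add]; ring_nf
  have h2 : IntegrableOn (fun x : ℝ => x ^ (-1 : ℝ)) (Set.Ioo 0 1) := by
    have := hint.const_mul c⁻¹
    rw [IntegrableOn]
    simpa [← mul_assoc, inv_mul_cancel₀ hc0.ne'] using this
  rw [intervalIntegral.integrableOn_Ioo_rpow_iff zero_lt_one] at h2
  linarith

theorem mass_pos (b θ : ℝ) : 0 < mass b θ := by
  rcases le_or_gt b 0 with hb | hb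
  · simp [mass_eq_top_of_nonpos hb]
  rcases lt_or_ge θ 0 with hθ | hθ
  · simp [mass_eq_top_of_neg b hθ]
  · rw [mass_eq_ofReal hb hθ]
    simpa using moment_one_pos hb hθ

theorem pos_and_nonneg_of_mass_ne_top {b θ : ℝ} (h : mass b θ ≠ ⊤) : 0 < b ∧ 0 ≤ θ := by
  constructor
  · by_contra hb
    exact h (mass_eq_top_of_nonpos (not_lt.1 hb) θ)
  · by_contra hθ
    exact h (mass_eq_top_of_neg b (not_le.1 hθ))

theorem mass_strictAnti {b θ θ' : ℝ} (h : θ < θ') (hf : mass b θ ≠ ⊤) :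
    mass b θ' < mass b θ := by
  obtain ⟨hb, hθ⟩ := pos_and_nonneg_of_mass_ne_top hf
  have hθ' : 0 ≤ θ' := hθ.trans h.le
  rw [mass_eq_ofReal hb hθ, mass_eq_ofReal hb hθ',
    ENNReal.ofReal_lt_ofReal_iff (moment_one_pos hb hθ)]
  have hi := integrableOn_momentKernel_of_nonneg 1 hb hθ
  have hi' := integrableOn_momentKernel_of_nonneg 1 hb hθ'
  rw [← sub_pos, moment, moment, ← Nat.cast_one (R := ℤ), ← integral_sub hi hi']
  have key : ∀ p : ℝ, 0 < p → 0 < p ^ ((1 : ℕ) : ℤ) * Real.exp (-b * p ^ 2 / 2 - θ / p) -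
      p ^ ((1 : ℕ) : ℤ) * Real.exp (-b * p ^ 2 / 2 - θ' / p) := by
    intro p hp
    have : Real.exp (-b * p ^ 2 / 2 - θ' / p) < Real.exp (-b * p ^ 2 / 2 - θ / p) := by
      refine Real.exp_lt_exp.2 ?_
      have : θ / p < θ' / p := by gcongr
      linarith
    have hp1 : 0 < p ^ ((1 : ℕ) : ℤ) := by positivity
    exact sub_pos.2 (mul_lt_mul_of_pos_left this hp1)
  refine (setIntegral_pos_iff_support_of_nonneg_ae ?_ (hi.sub hi')).2 ?_
  · exact (ae_restrict_iff' measurableSet_Ioi).2 (Eventually.of_forall fun p hp => (key p hp).le)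
  · refine lt_of_lt_of_le ?_ (measure_mono fun p (hp : p ∈ Set.Ioi 0) => ⟨(key p hp).ne', hp⟩)
    simp

theorem integral_linearCombination_three {μ : Measure ℝ} {f g h : ℝ → ℝ} (a b c : ℝ)
    (hf : Integrable f μ) (hg : Integrable g μ) (hh : Integrable h μ) :
    Integrable (fun x => a * f x + b * g x + c * h x) μ ∧
      ∫ x, (a * f x + b * g x + c * h x) ∂μ =
        a * ∫ x, f x ∂μ + b * ∫ x, g x ∂μ + c * ∫ x, h x ∂μ := by
  have hfg : Integrable (fun x => a * f x + b * g x) μ := (hf.const_mul a).add (hg.const_mul b)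
  refine ⟨hfg.add (hh.const_mul c), ?_⟩
  rw [integral_add hfg (hh.const_mul c), integral_add (hf.const_mul a) (hg.const_mul b)]
  simp only [integral_const_mul]

/-- Differentiation under the integral: `b` raises the power by 2 and `θ` lowers it by 1. Halving
both parameters gives a dominating function on a neighbourhood; `θ > 0` is what allows negative
powers. -/
theorem hasFDerivAt_moment (a : ℤ) {b θ : ℝ} (hb : 0 < b) (hθ : 0 < θ) :
    HasFDerivAt (fun q : ℝ × ℝ => moment a q.1 q.2)
      ((-(1 / 2) * moment (a + 2) b θ) • ContinuousLinearMap.fst ℝ ℝ ℝ +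
        (-moment (a - 1) b θ) • ContinuousLinearMap.snd ℝ ℝ ℝ) (b, θ) := by
  have hi := integrableOn_momentKernel (a + 2) hb hθ
  have hi' := integrableOn_momentKernel (a - 1) hb hθ
  have hin : Integrable (fun p : ℝ => -(p ^ (a - 1) * Real.exp (-b * p ^ 2 / 2 - θ / p)))
      (volume.restrict (Set.Ioi 0)) := hi'.neg
  have hs : {q : ℝ × ℝ | b / 2 < q.1 ∧ θ / 2 < q.2} ∈ 𝓝 (b, θ) :=
    ((isOpen_lt continuous_const continuous_fst).inter
      (isOpen_lt continuous_const continuous_snd)).mem_nhds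
      ⟨half_lt_self hb, half_lt_self hθ⟩
  have main := hasFDerivAt_integral_of_dominated_of_fderiv_le (𝕜 := ℝ)
    (μ := volume.restrict (Set.Ioi (0 : ℝ))) (x₀ := (b, θ)) (s := {q | b / 2 < q.1 ∧ θ / 2 < q.2})
    (F := fun (q : ℝ × ℝ) p => p ^ a * Real.exp (-q.1 * p ^ 2 / 2 - q.2 / p))
    (F' := fun q p => (-(1 / 2) * (p ^ (a + 2) * Real.exp (-q.1 * p ^ 2 / 2 - q.2 / p))) •
        ContinuousLinearMap.fst ℝ ℝ ℝ +
      (-(p ^ (a - 1) * Real.exp (-q.1 * p ^ 2 / 2 - q.2 / p))) • ContinuousLinearMap.snd ℝ ℝ ℝ)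
    (bound := fun p => 1 / 2 * (p ^ (a + 2) * Real.exp (-(b / 2) * p ^ 2 / 2 - θ / 2 / p)) +
      p ^ (a - 1) * Real.exp (-(b / 2) * p ^ 2 / 2 - θ / 2 / p))
    hs ?_ ?_ ?_ ?_ ?_ ?_
  · refine main.congr_fderiv ?_
    rw [integral_add ((hi.const_mul _).smul_const _) (hin.smul_const _), integral_smul_const,
      integral_smul_const, integral_const_mul, integral_neg]
    rfl
  · exact Eventually.of_forall fun q => (measurable_momentKernel a q.1 q.2).aestronglyMeasurable
  · exact integrableOn_momentKernel a hb hθ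
  · exact ((hi.const_mul _).smul_const _).aestronglyMeasurable.add
      (hin.smul_const _).aestronglyMeasurable
  · refine (ae_restrict_iff' measurableSet_Ioi).2 (Eventually.of_forall fun p hp q hq => ?_)
    have hp : 0 < p := hp
    obtain ⟨hq1, hq2⟩ := hq
    have he : Real.exp (-q.1 * p ^ 2 / 2 - q.2 / p) ≤
        Real.exp (-(b / 2) * p ^ 2 / 2 - θ / 2 / p) := by gcongr
    refine (norm_add_le _ _).trans (add_le_add ?_ ?_)
    · rw [norm_smul, neg_mul, norm_neg, Real.norm_of_nonneg (by positivity)]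
      calc _ ≤ 1 / 2 * (p ^ (a + 2) * Real.exp (-q.1 * p ^ 2 / 2 - q.2 / p)) * 1 := by
            gcongr; exact ContinuousLinearMap.norm_fst_le ℝ ℝ ℝ
        _ ≤ _ := by rw [mul_one]; gcongr
    · rw [norm_smul, norm_neg, Real.norm_of_nonneg (by positivity)]
      calc _ ≤ (p ^ (a - 1) * Real.exp (-q.1 * p ^ 2 / 2 - q.2 / p)) * 1 := by
            gcongr; exact ContinuousLinearMap.norm_snd_le ℝ ℝ ℝ
        _ ≤ _ := by rw [mul_one]; gcongr
  · exact ((integrableOn_momentKernel (a + 2) (half_pos hb) (half_pos hθ)).const_mul _).add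
      (integrableOn_momentKernel (a - 1) (half_pos hb) (half_pos hθ))
  · refine (ae_restrict_iff' measurableSet_Ioi).2 (Eventually.of_forall fun p hp q _ => ?_)
    have hp : 0 < p := hp
    have h1 : HasFDerivAt (fun q : ℝ × ℝ => -q.1 * p ^ 2 / 2 - q.2 / p)
        ((-(p ^ 2 / 2)) • ContinuousLinearMap.fst ℝ ℝ ℝ +
          (-p⁻¹) • ContinuousLinearMap.snd ℝ ℝ ℝ) q := by
      have h := ((-(p ^ 2 / 2)) • ContinuousLinearMap.fst ℝ ℝ ℝ +
          (-p⁻¹) • ContinuousLinearMap.snd ℝ ℝ ℝ).hasFDerivAt (x := q)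
      refine h.congr_of_eventuallyEq (Eventually.of_forall fun x => ?_)
      simp
      ring
    refine (h1.exp.const_mul (p ^ a)).congr_fderiv ?_
    rw [zpow_add₀ hp.ne', zpow_sub₀ hp.ne']
    ext <;> simp <;> ring

/-- The partial derivatives are again moments, so the order of smoothness is bootstrapped for all
powers `a` at once. -/
theorem contDiffOn_moment (a : ℤ) :
    ContDiffOn ℝ (⊤ : ℕ∞) (fun q : ℝ × ℝ => moment a q.1 q.2) (Set.Ioi 0 ×ˢ Set.Ioi 0) := by
  refine contDiffOn_infty.2 fun n => ?_
  have hU : IsOpen (Set.Ioi (0 : ℝ) ×ˢ Set.Ioi (0 : ℝ)) := isOpen_Ioi.prod isOpen_Ioi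
  have hd : ∀ a : ℤ, ∀ q ∈ Set.Ioi (0 : ℝ) ×ˢ Set.Ioi (0 : ℝ),
      HasFDerivWithinAt (fun q : ℝ × ℝ => moment a q.1 q.2)
      ((-(1 / 2) * moment (a + 2) q.1 q.2) • ContinuousLinearMap.fst ℝ ℝ ℝ +
        (-moment (a - 1) q.1 q.2) • ContinuousLinearMap.snd ℝ ℝ ℝ)
      (Set.Ioi 0 ×ˢ Set.Ioi 0) q :=
    fun a q hq => (hasFDerivAt_moment a hq.1 hq.2).hasFDerivWithinAt
  induction n generalizing a with
  | zero =>
    exact contDiffOn_zero.2 fun q hq => (hd a q hq).continuousWithinAt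
  | succ n ih =>
    push_cast
    refine (contDiffOn_succ_iff_hasFDerivWithinAt_of_uniqueDiffOn hU.uniqueDiffOn).2
      ⟨by simp, _, ?_, hd a⟩
    exact ((contDiffOn_const.mul (ih (a + 2))).smul contDiffOn_const).add
      ((ih (a - 1)).neg.smul contDiffOn_const)

/-! ### Convexity inequalities, semicontinuity and the slope at the origin -/

/-- Jensen's inequality for the exponential family of densities `p e^{-b p²/2 - θ/p}`. -/
theorem moment_mul_exp_le {b θ b' θ' : ℝ} (hb : 0 < b) (hθ : 0 ≤ θ) (hb' : 0 < b') (hθ' : 0 ≤ θ') :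
    moment 1 b θ * Real.exp
      ((-(b' - b) / 2 * moment 3 b θ - (θ' - θ) * moment 0 b θ) / moment 1 b θ) ≤
      moment 1 b' θ' := by
  have h1 := integrableOn_momentKernel_of_nonneg 1 hb hθ
  have h3 := integrableOn_momentKernel_of_nonneg 3 hb hθ
  have h0 := integrableOn_momentKernel_of_nonneg 0 hb hθ
  have h1' := integrableOn_momentKernel_of_nonneg 1 hb' hθ'
  have hpos := moment_one_pos hb hθ
  -- `m` is the mean, under the normalised density at `(b, θ)`, of the exponent difference `X`
  -- below. Integrating the tangent bound `e^X ≥ e^m (1 + X - m)` therefore leaves exactly `e^m`.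
  set m := (-(b' - b) / 2 * moment 3 b θ - (θ' - θ) * moment 0 b θ) / moment 1 b θ with hm
  simp only [Nat.cast_one, Nat.cast_zero, Nat.cast_ofNat] at h1 h3 h0 h1'
  have e : moment 1 b θ * Real.exp m = ∫ p in Set.Ioi (0 : ℝ),
      (Real.exp m * (1 - m) * (p ^ (1 : ℤ) * Real.exp (-b * p ^ 2 / 2 - θ / p)) +
      -(Real.exp m * (b' - b) / 2) * (p ^ (3 : ℤ) * Real.exp (-b * p ^ 2 / 2 - θ / p)) +
      -(Real.exp m * (θ' - θ)) * (p ^ (0 : ℤ) * Real.exp (-b * p ^ 2 / 2 - θ / p))) := by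
    rw [(integral_linearCombination_three _ _ _ h1 h3 h0).2]
    change _ = Real.exp m * (1 - m) * moment 1 b θ + -(Real.exp m * (b' - b) / 2) * moment 3 b θ +
      -(Real.exp m * (θ' - θ)) * moment 0 b θ
    have : m * moment 1 b θ = -(b' - b) / 2 * moment 3 b θ - (θ' - θ) * moment 0 b θ :=
      div_mul_cancel₀ _ hpos.ne'
    linear_combination Real.exp m * this
  rw [e]
  refine setIntegral_mono_on (((h1.const_mul _).add (h3.const_mul _)).add (h0.const_mul _)) h1'
    measurableSet_Ioi fun p hp => ?_
  have hp : 0 < p := hp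
  set X := -(b' - b) * p ^ 2 / 2 - (θ' - θ) / p with hX
  have hexp : Real.exp m * (1 + X - m) ≤ Real.exp X := by
    have := Real.add_one_le_exp (X - m)
    calc _ ≤ Real.exp m * Real.exp (X - m) := by gcongr; linarith
      _ = _ := by rw [← Real.exp_add]; ring_nf
  have hsplit : Real.exp (-b' * p ^ 2 / 2 - θ' / p) =
      Real.exp (-b * p ^ 2 / 2 - θ / p) * Real.exp X := by
    rw [← Real.exp_add, hX]
    ring_nf
  rw [hsplit, zpow_one]
  have : p * Real.exp (-b * p ^ 2 / 2 - θ / p) * (Real.exp m * (1 + X - m)) ≤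
      p * Real.exp (-b * p ^ 2 / 2 - θ / p) * Real.exp X := by gcongr
  refine le_trans (le_of_eq ?_) (this.trans (le_of_eq (by ring)))
  have h3' : p ^ (3 : ℤ) = p ^ 3 := by norm_cast
  rw [hX, h3', zpow_zero]
  field_simp
  ring

/-- Strict Cauchy–Schwarz inequality for `α p² + γ / p` under the density `p e^{-b p²/2 - θ/p}`. -/
theorem sq_moment_lt {b θ α : ℝ} (γ : ℝ) (hb : 0 < b) (hθ : 0 < θ) (hα : α ≠ 0) :
    (α * moment 3 b θ + γ * moment 0 b θ) ^ 2 < moment 1 b θ *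
      (α ^ 2 * moment 5 b θ + 2 * α * γ * moment 2 b θ + γ ^ 2 * moment (-1) b θ) := by
  have hpos := moment_one_pos hb hθ.le
  set c := (α * moment 3 b θ + γ * moment 0 b θ) / moment 1 b θ with hc
  have h1 := integrableOn_momentKernel 1 hb hθ
  have h3 := integrableOn_momentKernel 3 hb hθ
  have h0 := integrableOn_momentKernel 0 hb hθ
  have h5 := integrableOn_momentKernel 5 hb hθ
  have h2 := integrableOn_momentKernel 2 hb hθ
  have hn := integrableOn_momentKernel (-1) hb hθ
  set g : ℝ → ℝ := fun p =>
      (α ^ 2 * (p ^ (5 : ℤ) * Real.exp (-b * p ^ 2 / 2 - θ / p)) +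
      2 * α * γ * (p ^ (2 : ℤ) * Real.exp (-b * p ^ 2 / 2 - θ / p)) +
      γ ^ 2 * (p ^ (-1 : ℤ) * Real.exp (-b * p ^ 2 / 2 - θ / p))) +
      (-2 * c * α * (p ^ (3 : ℤ) * Real.exp (-b * p ^ 2 / 2 - θ / p)) +
      -2 * c * γ * (p ^ (0 : ℤ) * Real.exp (-b * p ^ 2 / 2 - θ / p)) +
      c ^ 2 * (p ^ (1 : ℤ) * Real.exp (-b * p ^ 2 / 2 - θ / p))) with hg
  have hgi : IntegrableOn g (Set.Ioi 0) :=
    (((h5.const_mul _).add (h2.const_mul _)).add (hn.const_mul _)).add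
      (((h3.const_mul _).add (h0.const_mul _)).add (h1.const_mul _))
  have hgeq : ∀ p ∈ Set.Ioi (0 : ℝ), g p =
      p * Real.exp (-b * p ^ 2 / 2 - θ / p) * (α * p ^ 2 + γ / p - c) ^ 2 := by
    intro p hp
    have hp : 0 < p := hp
    have h3' : p ^ (3 : ℤ) = p ^ 3 := by norm_cast
    have h5' : p ^ (5 : ℤ) = p ^ 5 := by norm_cast
    have h2' : p ^ (2 : ℤ) = p ^ 2 := by norm_cast
    simp only [hg, h3', h5', h2', zpow_zero, zpow_one, zpow_neg_one]
    field_simp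
    ring
  have hgint : ∫ p in Set.Ioi (0 : ℝ), g p =
      (α ^ 2 * moment 5 b θ + 2 * α * γ * moment 2 b θ + γ ^ 2 * moment (-1) b θ) +
      (-2 * c * α * moment 3 b θ + -2 * c * γ * moment 0 b θ + c ^ 2 * moment 1 b θ) := by
    simp only [hg]
    rw [integral_add (integral_linearCombination_three _ _ _ h5 h2 hn).1
      (integral_linearCombination_three _ _ _ h3 h0 h1).1,
      (integral_linearCombination_three _ _ _ h5 h2 hn).2,
      (integral_linearCombination_three _ _ _ h3 h0 h1).2]
    rfl
  have hnn : 0 ≤ᵐ[volume.restrict (Set.Ioi 0)] g := by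
    refine (ae_restrict_iff' measurableSet_Ioi).2 (Eventually.of_forall fun p hp => ?_)
    have hp' : 0 < p := hp
    show 0 ≤ g p
    rw [hgeq p hp]
    positivity
  have hgpos : 0 < ∫ p in Set.Ioi (0 : ℝ), g p := by
    refine lt_of_le_of_ne (integral_nonneg_of_ae hnn) fun h0 => hα ?_
    have hae := (integral_eq_zero_iff_of_nonneg_ae hnn hgi).1 h0.symm
    have hcont : ContinuousOn g (Set.Ioi 0) := by
      refine ContinuousOn.congr (f := fun p =>
        p * Real.exp (-b * p ^ 2 / 2 - θ / p) * (α * p ^ 2 + γ / p - c) ^ 2) ?_ hgeq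
      have : ∀ p ∈ Set.Ioi (0 : ℝ), p ≠ 0 := fun p hp => ne_of_gt hp
      fun_prop (disch := assumption)
    have hz := Measure.eqOn_open_of_ae_eq hae isOpen_Ioi hcont continuousOn_const
    have key : ∀ p : ℝ, 0 < p → α * p ^ 2 + γ / p - c = 0 := by
      intro p hp
      have := hz hp
      rw [hgeq p hp] at this
      simpa [hp.ne'] using this
    -- Equality would make `α p² + γ/p` constant in `p`; three values of `p` already force `α = 0`.
    have k1 := key 1 (by norm_num)
    have k2 := key 2 (by norm_num)
    have k4 := key 4 (by norm_num)
    linarith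
  rw [hgint] at hgpos
  have hcm : c * moment 1 b θ = α * moment 3 b θ + γ * moment 0 b θ := div_mul_cancel₀ _ hpos.ne'
  have := mul_pos hpos hgpos
  have e : (-2 * c * α * moment 3 b θ + -2 * c * γ * moment 0 b θ + c ^ 2 * moment 1 b θ) =
      -c ^ 2 * moment 1 b θ := by linear_combination 2 * c * hcm
  rw [e] at this
  rw [← hcm]
  linarith

/-- Fatou's lemma. Continuity fails at the edge `θ = 0`, where `mass` can jump from a finite value
to `⊤`; semicontinuity suffices for the region to be closed. -/
theorem lowerSemicontinuous_mass : LowerSemicontinuous fun q : ℝ × ℝ => mass q.1 q.2 := by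
  rw [lowerSemicontinuous_iff_le_liminf]
  intro q
  refine le_trans (lintegral_mono_ae ?_) (lintegral_liminf_le' ?_)
  · refine Eventually.of_forall fun p => ?_
    have hc : Continuous fun q : ℝ × ℝ =>
        ENNReal.ofReal (p * Real.exp (-q.1 * p ^ 2 / 2 - q.2 / p)) := by
      refine ENNReal.continuous_ofReal.comp ?_
      simp only [div_eq_mul_inv]
      fun_prop
    exact (hc.tendsto q).liminf_eq.ge
  · intro q
    exact (by fun_prop : Measurable fun p : ℝ =>
      ENNReal.ofReal (p * Real.exp (-q.1 * p ^ 2 / 2 - q.2 / p))).aemeasurable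

theorem abs_exp_sub_one_le_mul_max (y : ℝ) : |Real.exp y - 1| ≤ |y| * max 1 (Real.exp y) := by
  rcases le_total y 0 with h | h
  · have h1 : Real.exp y ≤ 1 := Real.exp_le_one_iff.2 h
    have h2 := Real.add_one_le_exp y
    rw [abs_of_nonpos (by linarith), abs_of_nonpos h, max_eq_left h1]
    linarith
  · have h1 : 1 ≤ Real.exp y := Real.one_le_exp h
    have h2 := Real.add_one_le_exp (-y)
    rw [abs_of_nonneg (by linarith), abs_of_nonneg h, max_eq_right h1]
    have h3 : Real.exp y * Real.exp (-y) = 1 := by rw [← Real.exp_add]; simp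
    nlinarith [Real.exp_pos y]

/-- The limit is `E (s p²/2 - j/p)` under the wall law: `1/β` is the mean energy and `√(πβ/2)` the
mean flight time. Only a one-sided derivative is available, as the ray starts on the edge `θ = 0`.
Domination for `l ≤ β/2` gives up half of the Gaussian. -/
theorem tendsto_slope_moment {β s j : ℝ} (hβ : 0 < β) (hs : |s| ≤ 1) (hj : 0 ≤ j) :
    Tendsto (fun l => (β * moment 1 (β - s * l) (j * l) - 1) / l) (𝓝[>] 0)
      (𝓝 (s / β - j * √(Real.pi * β / 2))) := by
  have h1 := integrableOn_momentKernel_of_nonneg 1 hβ le_rfl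
  have h3 := integrableOn_momentKernel_of_nonneg 3 hβ le_rfl
  have h0 := integrableOn_momentKernel_of_nonneg 0 hβ le_rfl
  have h3' := integrableOn_momentKernel_of_nonneg 3 (half_pos hβ) le_rfl
  have h0' := integrableOn_momentKernel_of_nonneg 0 (half_pos hβ) le_rfl
  simp only [Nat.cast_one, Nat.cast_zero, Nat.cast_ofNat] at h1 h3 h0 h3' h0'
  have hsmall : ∀ᶠ l : ℝ in 𝓝[>] 0, 0 < l ∧ l ≤ β / 2 := by
    filter_upwards [self_mem_nhdsWithin,
      mem_nhdsWithin_of_mem_nhds (Iic_mem_nhds (half_pos hβ))] with l h1 h2 using ⟨h1, h2⟩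
  have main : Tendsto (fun l => ∫ p in Set.Ioi (0 : ℝ),
      p * Real.exp (-β * p ^ 2 / 2) * ((Real.exp (l * (s * p ^ 2 / 2 - j / p)) - 1) / l))
      (𝓝[>] 0) (𝓝 (∫ p in Set.Ioi (0 : ℝ),
        p * Real.exp (-β * p ^ 2 / 2) * (s * p ^ 2 / 2 - j / p))) := by
    refine tendsto_integral_filter_of_dominated_convergence (fun p =>
      1 / 2 * (p ^ (3 : ℤ) * Real.exp (-(β / 2) * p ^ 2 / 2 - 0 / p)) +
        j * (p ^ (0 : ℤ) * Real.exp (-(β / 2) * p ^ 2 / 2 - 0 / p))) ?_ ?_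
      ((h3'.const_mul _).add (h0'.const_mul _)) ?_
    · exact Eventually.of_forall fun l => Measurable.aestronglyMeasurable (by fun_prop)
    · filter_upwards [hsmall] with l hl
      refine (ae_restrict_iff' measurableSet_Ioi).2 (Eventually.of_forall fun p hp => ?_)
      have hp : 0 < p := hp
      obtain ⟨hl0, hl⟩ := hl
      have hs1 := (abs_le.1 hs).2
      have hsp : s * p ^ 2 / 2 ≤ p ^ 2 / 2 := by nlinarith [sq_nonneg p]
      have hjp : 0 ≤ j / p := by positivity
      have hX : |s * p ^ 2 / 2 - j / p| ≤ p ^ 2 / 2 + j / p := by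
        refine (abs_sub _ _).trans (add_le_add ?_ (abs_of_nonneg hjp).le)
        rw [abs_div, abs_mul, abs_of_nonneg (sq_nonneg p), abs_two]
        nlinarith [sq_nonneg p]
      have hexp : max 1 (Real.exp (l * (s * p ^ 2 / 2 - j / p))) ≤
          Real.exp (β / 2 * (p ^ 2 / 2)) := by
        refine max_le (Real.one_le_exp (by positivity)) (Real.exp_le_exp.2 ?_)
        calc l * (s * p ^ 2 / 2 - j / p) ≤ l * (p ^ 2 / 2) := by gcongr; linarith
          _ ≤ _ := by gcongr
      have hq : |(Real.exp (l * (s * p ^ 2 / 2 - j / p)) - 1) / l| ≤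
          (p ^ 2 / 2 + j / p) * Real.exp (β / 2 * (p ^ 2 / 2)) := by
        rw [abs_div, abs_of_pos hl0, div_le_iff₀ hl0]
        calc _ ≤ |l * (s * p ^ 2 / 2 - j / p)| * max 1 (Real.exp (l * (s * p ^ 2 / 2 - j / p))) :=
              abs_exp_sub_one_le_mul_max _
          _ ≤ (l * (p ^ 2 / 2 + j / p)) * Real.exp (β / 2 * (p ^ 2 / 2)) := by
              rw [abs_mul, abs_of_pos hl0]; gcongr
          _ = _ := by ring
      rw [norm_mul, Real.norm_of_nonneg (by positivity), Real.norm_eq_abs]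
      have hsplit : Real.exp (-(β / 2) * p ^ 2 / 2 - 0 / p) =
          Real.exp (-β * p ^ 2 / 2) * Real.exp (β / 2 * (p ^ 2 / 2)) := by
        rw [← Real.exp_add]; ring_nf
      have h3e : p ^ (3 : ℤ) = p ^ 3 := by norm_cast
      refine (mul_le_mul_of_nonneg_left hq (by positivity)).trans (le_of_eq ?_)
      rw [hsplit, h3e, zpow_zero]
      field_simp
    · refine Eventually.of_forall fun p => ?_
      refine Tendsto.const_mul _ ?_
      set X := s * p ^ 2 / 2 - j / p
      have hd : HasDerivAt (fun l : ℝ => Real.exp (l * X)) X 0 := by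
        have := ((hasDerivAt_id (0 : ℝ)).mul_const X).exp
        simpa using this
      have := (hasDerivAt_iff_tendsto_slope.1 hd).mono_left
        (nhdsWithin_mono 0 fun x (hx : x ∈ Set.Ioi 0) => ne_of_gt hx)
      refine this.congr fun l => ?_
      simp [slope_def_field]
  have hlim : s / β - j * √(Real.pi * β / 2) = β * ∫ p in Set.Ioi (0 : ℝ),
        p * Real.exp (-β * p ^ 2 / 2) * (s * p ^ 2 / 2 - j / p) := by
    have : ∫ p in Set.Ioi (0 : ℝ), p * Real.exp (-β * p ^ 2 / 2) * (s * p ^ 2 / 2 - j / p) =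
        s / 2 * moment 3 β 0 - j * moment 0 β 0 := by
      rw [moment, moment, ← integral_const_mul, ← integral_const_mul,
        ← integral_sub (h3.const_mul _) (h0.const_mul _)]
      refine setIntegral_congr_fun measurableSet_Ioi fun p hp => ?_
      have hp : 0 < p := hp
      have h3e : p ^ (3 : ℤ) = p ^ 3 := by norm_cast
      simp only [h3e, zpow_zero, zero_div, sub_zero]
      field_simp
    rw [this, ← moment_zero_zero hβ, moment_three_zero hβ]
    field_simp
  rw [hlim]
  refine (main.const_mul β).congr' ?_
  filter_upwards [hsmall] with l hl
  obtain ⟨hl0, hl⟩ := hl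
  have hs1 := (abs_le.1 hs).2
  have h1l := integrableOn_momentKernel_of_nonneg 1 (b := β - s * l) (θ := j * l)
    (by nlinarith) (by positivity)
  simp only [Nat.cast_one] at h1l
  have hβ1 : (1 : ℝ) = β * moment 1 β 0 := by rw [moment_one_zero hβ]; field_simp
  rw [show β * moment 1 (β - s * l) (j * l) - 1 =
    β * (moment 1 (β - s * l) (j * l) - moment 1 β 0) by rw [mul_sub, ← hβ1], mul_div_assoc]
  congr 1
  rw [moment, moment, ← integral_sub h1l h1, ← integral_div]
  refine setIntegral_congr_fun measurableSet_Ioi fun p hp => ?_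
  have hp : 0 < p := hp
  have hsplit : Real.exp (-(β - s * l) * p ^ 2 / 2 - j * l / p) =
      Real.exp (-β * p ^ 2 / 2) * Real.exp (l * (s * p ^ 2 / 2 - j / p)) := by
    rw [← Real.exp_add]; ring_nf
  simp only [hsplit, zpow_one, zero_div, sub_zero]
  ring

/-! ### The cycle transform and the region where it is at most 1 -/

/-- The exponential moment `E e^{λ ΔJ - θ Δt}` over one cycle, `ΔJ` being the energy exchanged and
`Δt` the duration of the cycle. -/
def cycleMass (βL βR l θ : ℝ) : ENNReal :=
  ENNReal.ofReal (βL * βR) * (mass (βL - l) θ * mass (βR + l) θ)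

/-- The region `{(λ, θ) : E e^{λ ΔJ - θ Δt} ≤ 1}`. -/
def epigraph (βL βR : ℝ) : Set (ℝ × ℝ) := {q | cycleMass βL βR q.1 q.2 ≤ 1}

/-- The support function `j ↦ sup (λ j - θ)` of the region `{(λ, θ) : E e^{λ ΔJ - θ Δt} ≤ 1}`. -/
def rate (βL βR j : ℝ) : ℝ := sSup ((fun q : ℝ × ℝ => q.1 * j - q.2) '' epigraph βL βR)

variable {βL βR : ℝ}

theorem cycleMass_eq_ofReal (hL : 0 < βL) (hR : 0 < βR) {l θ : ℝ} (h1 : 0 < βL - l)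
    (h2 : 0 < βR + l) (hθ : 0 ≤ θ) : cycleMass βL βR l θ =
      ENNReal.ofReal (βL * βR * (moment 1 (βL - l) θ * moment 1 (βR + l) θ)) := by
  have := moment_one_pos h1 hθ
  rw [cycleMass, mass_eq_ofReal h1 hθ, mass_eq_ofReal h2 hθ, ← ENNReal.ofReal_mul this.le,
    ← ENNReal.ofReal_mul (by positivity)]

theorem mass_ne_top_of_cycleMass_ne_top (hL : 0 < βL) (hR : 0 < βR) {l θ : ℝ}
    (h : cycleMass βL βR l θ ≠ ⊤) : mass (βL - l) θ ≠ ⊤ ∧ mass (βR + l) θ ≠ ⊤ := by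
  have hC : ENNReal.ofReal (βL * βR) ≠ 0 := by simpa using mul_pos hL hR
  have h1 : mass (βL - l) θ * mass (βR + l) θ ≠ ⊤ := fun e => h (by
    rw [cycleMass, e, ENNReal.mul_top hC])
  constructor
  · exact fun e => h1 (by rw [e, ENNReal.top_mul (mass_pos _ _).ne'])
  · exact fun e => h1 (by rw [e, ENNReal.mul_top (mass_pos _ _).ne'])

theorem bounds_of_cycleMass_ne_top (hL : 0 < βL) (hR : 0 < βR) {l θ : ℝ}
    (h : cycleMass βL βR l θ ≠ ⊤) : 0 < βL - l ∧ 0 < βR + l ∧ 0 ≤ θ := by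
  obtain ⟨h1, h2⟩ := mass_ne_top_of_cycleMass_ne_top hL hR h
  exact ⟨(pos_and_nonneg_of_mass_ne_top h1).1, (pos_and_nonneg_of_mass_ne_top h2).1,
    (pos_and_nonneg_of_mass_ne_top h1).2⟩

theorem cycleMass_strictAnti (hL : 0 < βL) (hR : 0 < βR) {l θ θ' : ℝ} (h : θ < θ')
    (hf : cycleMass βL βR l θ ≠ ⊤) : cycleMass βL βR l θ' < cycleMass βL βR l θ := by
  obtain ⟨h1, h2⟩ := mass_ne_top_of_cycleMass_ne_top hL hR hf
  have hC : ENNReal.ofReal (βL * βR) ≠ 0 := by simpa using mul_pos hL hR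
  exact (ENNReal.mul_lt_mul_iff_right hC ENNReal.ofReal_ne_top).2
    (ENNReal.mul_lt_mul (mass_strictAnti h h1) (mass_strictAnti h h2))

theorem bounds_of_mem_epigraph (hL : 0 < βL) (hR : 0 < βR) {q : ℝ × ℝ}
    (hq : q ∈ epigraph βL βR) : 0 < βL - q.1 ∧ 0 < βR + q.1 ∧ 0 ≤ q.2 :=
  bounds_of_cycleMass_ne_top hL hR (ne_top_of_le_ne_top ENNReal.one_ne_top hq)

theorem mem_epigraph_iff (hL : 0 < βL) (hR : 0 < βR) {q : ℝ × ℝ} (h1 : 0 < βL - q.1)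
    (h2 : 0 < βR + q.1) (hθ : 0 ≤ q.2) : q ∈ epigraph βL βR ↔
      βL * βR * (moment 1 (βL - q.1) q.2 * moment 1 (βR + q.1) q.2) ≤ 1 := by
  rw [epigraph, Set.mem_ofPred_eq, cycleMass_eq_ofReal hL hR h1 h2 hθ]
  simp

theorem isClosed_epigraph (hL : 0 < βL) (hR : 0 < βR) : IsClosed (epigraph βL βR) := by
  have h1 : LowerSemicontinuous fun q : ℝ × ℝ => mass (βL - q.1) q.2 :=
    lowerSemicontinuous_mass.comp (g := fun q : ℝ × ℝ => (βL - q.1, q.2))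
      (by fun_prop)
  have h2 : LowerSemicontinuous fun q : ℝ × ℝ => mass (βR + q.1) q.2 :=
    lowerSemicontinuous_mass.comp (g := fun q : ℝ × ℝ => (βR + q.1, q.2))
      (by fun_prop)
  have h3 : LowerSemicontinuous fun q : ℝ × ℝ => cycleMass βL βR q.1 q.2 := by
    rw [lowerSemicontinuous_iff_le_liminf] at *
    intro q
    have hm : mass (βL - q.1) q.2 * mass (βR + q.1) q.2 ≤
        liminf (fun q : ℝ × ℝ => mass (βL - q.1) q.2 * mass (βR + q.1) q.2) (𝓝 q) :=
      (mul_le_mul' (h1 q) (h2 q)).trans ENNReal.le_liminf_mul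
    rw [cycleMass]
    simp only [cycleMass]
    rw [ENNReal.liminf_const_mul_of_ne_zero_of_ne_top (by simpa using mul_pos hL hR)
      ENNReal.ofReal_ne_top]
    gcongr
  exact h3.isClosed_preimage 1

/-- The map `λ ↦ β_L - β_R - λ` exchanges `β_L - λ` and `β_R + λ`, hence the two factors of the
cycle transform. -/
theorem reflect_mem_epigraph {q : ℝ × ℝ} (hq : q ∈ epigraph βL βR) :
    (βL - βR - q.1, q.2) ∈ epigraph βL βR := by
  simp only [epigraph, Set.mem_ofPred_eq, cycleMass] at hq ⊢
  rw [mul_comm (mass _ _)] at hq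
  convert hq using 4 <;> ring_nf

theorem zero_mem_epigraph (hL : 0 < βL) (hR : 0 < βR) : (0, 0) ∈ epigraph βL βR := by
  rw [mem_epigraph_iff hL hR (by simpa using hL) (by simpa using hR) le_rfl]
  simp only [sub_zero, add_zero]
  rw [moment_one_zero hL, moment_one_zero hR]
  apply le_of_eq
  field_simp

theorem conductivity_pos (hL : 0 < βL) : 0 < conductivity βL βR := by
  rw [conductivity]
  have : 0 < √(Real.pi * βL / 2) := Real.sqrt_pos.2 (by positivity)
  have := Real.sqrt_nonneg (Real.pi * βR / 2)
  positivity

theorem jStar_nonneg (hL : 0 < βL) (hLR : βL ≤ βR) : 0 ≤ jStar βL βR := by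
  rw [jStar]
  refine mul_nonneg (conductivity_pos hL).le (sub_nonneg.2 ?_)
  exact one_div_le_one_div_of_le hL hLR

theorem jStar_eq (hL : 0 < βL) :
    jStar βL βR * (√(Real.pi * βL / 2) + √(Real.pi * βR / 2)) = 1 / βL - 1 / βR := by
  have : 0 < √(Real.pi * βL / 2) := Real.sqrt_pos.2 (by positivity)
  have := Real.sqrt_nonneg (Real.pi * βR / 2)
  rw [jStar, conductivity]
  field_simp

/-- Jensen's inequality based at `(0, 0)`: the logarithm of the transform is at least its
linearisation `λ (T_L - T_R) - θ/κ`, which must then be nonpositive on the region. -/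
theorem mul_jStar_le_of_mem_epigraph (hL : 0 < βL) (hR : 0 < βR) {q : ℝ × ℝ}
    (hq : q ∈ epigraph βL βR) : q.1 * jStar βL βR ≤ q.2 := by
  obtain ⟨h1, h2, h3⟩ := bounds_of_mem_epigraph hL hR hq
  rw [mem_epigraph_iff hL hR h1 h2 h3] at hq
  have k1 := moment_mul_exp_le hL le_rfl h1 h3
  have k2 := moment_mul_exp_le hR le_rfl h2 h3
  rw [moment_one_zero hL, moment_three_zero hL] at k1
  rw [moment_one_zero hR, moment_three_zero hR] at k2
  have m1 := moment_zero_zero hL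
  have m2 := moment_zero_zero hR
  have e1 : (-(βL - q.1 - βL) / 2 * (2 / βL ^ 2) - (q.2 - 0) * moment 0 βL 0) / (1 / βL) =
      q.1 / βL - q.2 * √(Real.pi * βL / 2) := by
    rw [← m1]; field_simp; ring
  have e2 : (-(βR + q.1 - βR) / 2 * (2 / βR ^ 2) - (q.2 - 0) * moment 0 βR 0) / (1 / βR) =
      -(q.1 / βR) - q.2 * √(Real.pi * βR / 2) := by
    rw [← m2]; field_simp; ring
  rw [e1] at k1
  rw [e2] at k2
  have k := mul_le_mul k1 k2 (by positivity) (moment_one_pos h1 h3).le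
  have hexp : Real.exp ((q.1 / βL - q.2 * √(Real.pi * βL / 2)) +
      (-(q.1 / βR) - q.2 * √(Real.pi * βR / 2))) ≤ 1 := by
    rw [Real.exp_add]
    refine le_trans (le_of_eq ?_) ((mul_le_mul_of_nonneg_left k (mul_pos hL hR).le).trans hq)
    field_simp
  rw [Real.exp_le_one_iff] at hexp
  have hs : 0 < √(Real.pi * βL / 2) + √(Real.pi * βR / 2) := by
    have : 0 < √(Real.pi * βL / 2) := Real.sqrt_pos.2 (by positivity)
    have := Real.sqrt_nonneg (Real.pi * βR / 2)
    positivity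
  refine le_of_mul_le_mul_right ?_ hs
  rw [mul_assoc, jStar_eq hL]
  linarith [show q.1 * (1 / βL - 1 / βR) = q.1 / βL - q.1 / βR by ring]

/-- Along a ray `θ = j' λ` with `j* < j' < j`, the sum of the one-sided derivatives of the two
normalised factors at the origin is negative, so the ray enters the region for small `λ > 0`. -/
theorem exists_mem_epigraph_lt (hL : 0 < βL) (hLR : βL ≤ βR) {j : ℝ} (hj : jStar βL βR < j) :
    ∃ q ∈ epigraph βL βR, 0 < q.1 * j - q.2 := by
  have hR := hL.trans_le hLR
  have hj0 : 0 < j := (jStar_nonneg hL hLR).trans_lt hj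
  obtain ⟨j', hj1, hj2⟩ := exists_between hj
  have hj0' : 0 < j' := (jStar_nonneg hL hLR).trans_lt hj1
  have t1 := tendsto_slope_moment (s := 1) hL (by simp) hj0'.le
  have t2 := tendsto_slope_moment (s := -1) hR (by simp) hj0'.le
  have hneg : 1 / βL - j' * √(Real.pi * βL / 2) + (-1 / βR - j' * √(Real.pi * βR / 2)) < 0 := by
    have hs : 0 < √(Real.pi * βL / 2) + √(Real.pi * βR / 2) := by
      have : 0 < √(Real.pi * βL / 2) := Real.sqrt_pos.2 (by positivity)
      have := Real.sqrt_nonneg (Real.pi * βR / 2)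
      positivity
    have := mul_lt_mul_of_pos_right hj1 hs
    rw [jStar_eq hL] at this
    have e : -1 / βR = -(1 / βR) := by ring
    rw [e]
    linarith
  have hev := (t1.add t2).eventually (gt_mem_nhds hneg)
  obtain ⟨l, ⟨hl, hl0⟩, hlL⟩ := ((hev.and self_mem_nhdsWithin).and
    (mem_nhdsWithin_of_mem_nhds (Iio_mem_nhds hL))).exists
  have hl0 : 0 < l := hl0
  have hlL : l < βL := hlL
  have h1 : 0 < βL - l := by linarith
  have h2 : 0 < βR + l := by linarith
  have hθ : 0 ≤ j' * l := by positivity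
  refine ⟨(l, j' * l), ?_, ?_⟩
  · rw [mem_epigraph_iff hL hR h1 h2 hθ]
    rw [← add_div, div_lt_iff₀ hl0, zero_mul] at hl
    rw [one_mul, neg_one_mul, sub_neg_eq_add] at hl
    have p1 := mul_pos hL (moment_one_pos h1 hθ)
    have p2 := mul_pos hR (moment_one_pos h2 hθ)
    calc _ = (βL * moment 1 (βL - l) (j' * l)) * (βR * moment 1 (βR + l) (j' * l)) := by ring
      -- The two factors are positive with sum below 2, so their product is at most 1 by the
      -- arithmetic–geometric mean inequality.
      _ ≤ 1 := by nlinarith [sq_nonneg (βL * moment 1 (βL - l) (j' * l) -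
                    βR * moment 1 (βR + l) (j' * l))]
  · have := mul_lt_mul_of_pos_left hj2 hl0
    show 0 < l * j - j' * l
    linarith

/-! ### The support function: attainment, convexity, symmetry, zeros -/

/-- The region is closed with `λ` bounded and `θ ≥ 0`, so its part with nonnegative objective is
compact; that part contains `(0, 0)`. -/
theorem exists_isMaxOn_epigraph (hL : 0 < βL) (hR : 0 < βR) (j : ℝ) :
    ∃ q ∈ epigraph βL βR, ∀ q' ∈ epigraph βL βR, q'.1 * j - q'.2 ≤ q.1 * j - q.2 := by
  have hc : Continuous fun q : ℝ × ℝ => q.1 * j - q.2 := by fun_prop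
  have hclosed : IsClosed (epigraph βL βR ∩ {q | 0 ≤ q.1 * j - q.2}) :=
    (isClosed_epigraph hL hR).inter (isClosed_le continuous_const hc)
  have hsub : epigraph βL βR ∩ {q | 0 ≤ q.1 * j - q.2} ⊆
      Set.Icc (-βR) βL ×ˢ Set.Icc 0 ((βL + βR) * |j|) := by
    rintro q ⟨hq, hq'⟩
    have hq' : 0 ≤ q.1 * j - q.2 := hq'
    obtain ⟨h1, h2, h3⟩ := bounds_of_mem_epigraph hL hR hq
    refine ⟨⟨by linarith, by linarith⟩, h3, ?_⟩
    have : q.1 * j ≤ |q.1| * |j| := by rw [← abs_mul]; exact le_abs_self _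
    have : |q.1| ≤ βL + βR := abs_le.2 ⟨by linarith, by linarith⟩
    nlinarith [abs_nonneg j]
  have hcomp := (isCompact_Icc.prod isCompact_Icc).of_isClosed_subset hclosed hsub
  obtain ⟨q, hq, hmax⟩ := hcomp.exists_isMaxOn ⟨(0, 0), zero_mem_epigraph hL hR, by simp⟩
    hc.continuousOn
  refine ⟨q, hq.1, fun q' hq' => ?_⟩
  rcases le_or_gt 0 (q'.1 * j - q'.2) with h | h
  · exact hmax ⟨hq', h⟩
  · exact h.le.trans hq.2

theorem rate_eq_of_isMaxOn {j : ℝ} {q : ℝ × ℝ} (hq : q ∈ epigraph βL βR)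
    (hmax : ∀ q' ∈ epigraph βL βR, q'.1 * j - q'.2 ≤ q.1 * j - q.2) :
    rate βL βR j = q.1 * j - q.2 :=
  IsGreatest.csSup_eq ⟨⟨q, hq, rfl⟩, by rintro _ ⟨q', hq', rfl⟩; exact hmax q' hq'⟩

theorem le_rate (hL : 0 < βL) (hR : 0 < βR) {q : ℝ × ℝ} (hq : q ∈ epigraph βL βR) (j : ℝ) :
    q.1 * j - q.2 ≤ rate βL βR j := by
  obtain ⟨q', hq', hmax⟩ := exists_isMaxOn_epigraph hL hR j
  rw [rate_eq_of_isMaxOn hq' hmax]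
  exact hmax q hq

theorem rate_nonneg (hL : 0 < βL) (hR : 0 < βR) (j : ℝ) : 0 ≤ rate βL βR j := by
  simpa using le_rate hL hR (zero_mem_epigraph hL hR) j

theorem convexOn_rate (hL : 0 < βL) (hR : 0 < βR) : ConvexOn ℝ Set.univ (rate βL βR) := by
  refine ⟨convex_univ, fun x _ y _ a b ha hb hab => ?_⟩
  obtain ⟨q, hq, hmax⟩ := exists_isMaxOn_epigraph hL hR (a • x + b • y)
  rw [rate_eq_of_isMaxOn hq hmax]
  have hx := mul_le_mul_of_nonneg_left (le_rate hL hR hq x) ha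
  have hy := mul_le_mul_of_nonneg_left (le_rate hL hR hq y) hb
  simp only [smul_eq_mul] at *
  have : q.2 = a * q.2 + b * q.2 := by rw [← add_mul, hab, one_mul]
  linarith

theorem rate_reflect (hL : 0 < βL) (hR : 0 < βR) (j : ℝ) :
    rate βL βR j = (βL - βR) * j + rate βL βR (-j) := by
  have key : ∀ j : ℝ, rate βL βR j ≤ (βL - βR) * j + rate βL βR (-j) := by
    intro j
    obtain ⟨q, hq, hmax⟩ := exists_isMaxOn_epigraph hL hR j
    rw [rate_eq_of_isMaxOn hq hmax]
    have := le_rate hL hR (reflect_mem_epigraph hq) (-j)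
    simp only at this
    linarith
  have := key (-j)
  rw [neg_neg] at this
  linarith [key j]

/-- For `λ ≤ 0` use `θ ≥ 0`, for `λ ≥ 0` use `θ ≥ λ j*`: in both cases `λ j - θ ≤ 0`. -/
theorem rate_eq_zero (hL : 0 < βL) (hR : 0 < βR) {j : ℝ} (hj : j ∈ Set.Icc 0 (jStar βL βR)) :
    rate βL βR j = 0 := by
  refine le_antisymm ?_ (rate_nonneg hL hR j)
  obtain ⟨q, hq, hmax⟩ := exists_isMaxOn_epigraph hL hR j
  rw [rate_eq_of_isMaxOn hq hmax]
  have h1 := mul_jStar_le_of_mem_epigraph hL hR hq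
  have h2 := (bounds_of_mem_epigraph hL hR hq).2.2
  rcases le_total q.1 0 with h | h
  · nlinarith [hj.1]
  · nlinarith [hj.2]

theorem rate_pos (hL : 0 < βL) (hLR : βL ≤ βR) {j : ℝ} (hj : jStar βL βR < j) :
    0 < rate βL βR j := by
  obtain ⟨q, hq, h⟩ := exists_mem_epigraph_lt hL hLR hj
  exact h.trans_le (le_rate hL (hL.trans_le hLR) hq j)

/-! ### The smooth boundary curve and its first- and second-order conditions -/

/-- The interior region `{(λ, θ) : -β_R < λ < β_L, θ > 0}`. -/
def smoothRegion (βL βR : ℝ) : Set (ℝ × ℝ) := {q | q.1 < βL ∧ -βR < q.1 ∧ 0 < q.2}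

/-- Real-valued version of `cycleMass`. -/
def cycleReal (βL βR : ℝ) (q : ℝ × ℝ) : ℝ :=
  βL * βR * (moment 1 (βL - q.1) q.2 * moment 1 (βR + q.1) q.2)

/-- `2 / (β_L β_R)` times the partial derivative in `λ` of `cycleReal`. -/
def slopeNum (βL βR : ℝ) (q : ℝ × ℝ) : ℝ :=
  moment 3 (βL - q.1) q.2 * moment 1 (βR + q.1) q.2 -
    moment 1 (βL - q.1) q.2 * moment 3 (βR + q.1) q.2

/-- `-2 / (β_L β_R)` times the partial derivative in `θ` of `cycleReal`. -/
def slopeDen (βL βR : ℝ) (q : ℝ × ℝ) : ℝ :=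
  2 * (moment 0 (βL - q.1) q.2 * moment 1 (βR + q.1) q.2 +
    moment 1 (βL - q.1) q.2 * moment 0 (βR + q.1) q.2)

theorem isOpen_smoothRegion : IsOpen (smoothRegion βL βR) :=
  (isOpen_lt continuous_fst continuous_const).inter
    ((isOpen_lt continuous_const continuous_fst).inter
      (isOpen_lt continuous_const continuous_snd))

theorem mem_epigraph_iff_cycleReal_le (hL : 0 < βL) (hR : 0 < βR) {q : ℝ × ℝ}
    (hq : q ∈ smoothRegion βL βR) : q ∈ epigraph βL βR ↔ cycleReal βL βR q ≤ 1 :=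
  mem_epigraph_iff hL hR (sub_pos.2 hq.1) (by linarith [hq.2.1]) hq.2.2.le

theorem moment_pos {a : ℤ} {b θ : ℝ} (hb : 0 < b) (hθ : 0 < θ) : 0 < moment a b θ := by
  have hi := integrableOn_momentKernel a hb hθ
  refine (setIntegral_pos_iff_support_of_nonneg_ae ?_ hi).2 ?_
  · refine (ae_restrict_iff' measurableSet_Ioi).2 (Eventually.of_forall fun p hp => ?_)
    have hp : 0 < p := hp
    show 0 ≤ _
    positivity
  · refine lt_of_lt_of_le ?_ (measure_mono fun p (hp : p ∈ Set.Ioi 0) =>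
      ⟨Function.mem_support.2 (by have hp : 0 < p := hp
                                  positivity), hp⟩)
    simp

theorem slopeDen_pos {q : ℝ × ℝ} (hq : q ∈ smoothRegion βL βR) : 0 < slopeDen βL βR q := by
  have h1 : 0 < βL - q.1 := sub_pos.2 hq.1
  have h2 : 0 < βR + q.1 := by linarith [hq.2.1]
  have := moment_pos (a := 0) h1 hq.2.2
  have := moment_pos (a := 1) h1 hq.2.2
  have := moment_pos (a := 0) h2 hq.2.2
  have := moment_pos (a := 1) h2 hq.2.2
  rw [slopeDen]
  positivity

theorem hasDerivAt_moment_line (a : ℤ) {b θ : ℝ} (hb : 0 < b) (hθ : 0 < θ) (u v : ℝ) :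
    HasDerivAt (fun s : ℝ => moment a (b + s * u) (θ + s * v))
      (-(1 / 2) * u * moment (a + 2) b θ - v * moment (a - 1) b θ) 0 := by
  have h1 : HasDerivAt (fun s : ℝ => (b + s * u, θ + s * v)) (u, v) 0 := by
    have hu := ((hasDerivAt_id (0 : ℝ)).mul_const u).const_add b
    have hv := ((hasDerivAt_id (0 : ℝ)).mul_const v).const_add θ
    simpa using hu.prodMk hv
  have h2 : HasFDerivAt (fun q : ℝ × ℝ => moment a q.1 q.2)
      ((-(1 / 2) * moment (a + 2) b θ) • ContinuousLinearMap.fst ℝ ℝ ℝ +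
        (-moment (a - 1) b θ) • ContinuousLinearMap.snd ℝ ℝ ℝ)
      (b + 0 * u, θ + 0 * v) := by simpa using hasFDerivAt_moment a hb hθ
  refine (h2.comp_hasDerivAt (0 : ℝ) h1).congr_deriv ?_
  simp
  ring

theorem hasDerivAt_moment_left (a : ℤ) {q : ℝ × ℝ} (hq : q ∈ smoothRegion βL βR) (d : ℝ × ℝ) :
    HasDerivAt (fun s : ℝ => moment a (βL - (q + s • d).1) (q + s • d).2)
      (1 / 2 * d.1 * moment (a + 2) (βL - q.1) q.2 - d.2 * moment (a - 1) (βL - q.1) q.2) 0 := by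
  have h := hasDerivAt_moment_line a (sub_pos.2 hq.1) hq.2.2 (-d.1) d.2
  refine (h.congr_deriv (by ring)).congr_of_eventuallyEq (Eventually.of_forall fun s => ?_)
  simp only [Prod.fst_add, Prod.snd_add, Prod.smul_fst, Prod.smul_snd, smul_eq_mul]
  ring_nf

theorem hasDerivAt_moment_right (a : ℤ) {q : ℝ × ℝ} (hq : q ∈ smoothRegion βL βR) (d : ℝ × ℝ) :
    HasDerivAt (fun s : ℝ => moment a (βR + (q + s • d).1) (q + s • d).2)
      (-(1 / 2) * d.1 * moment (a + 2) (βR + q.1) q.2 -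
        d.2 * moment (a - 1) (βR + q.1) q.2) 0 := by
  have h := hasDerivAt_moment_line a (b := βR + q.1) (by linarith [hq.2.1]) hq.2.2 d.1 d.2
  refine h.congr_of_eventuallyEq (Eventually.of_forall fun s => ?_)
  simp only [Prod.fst_add, Prod.snd_add, Prod.smul_fst, Prod.smul_snd, smul_eq_mul]
  ring_nf

theorem hasDerivAt_cycleReal {q : ℝ × ℝ} (hq : q ∈ smoothRegion βL βR) (d : ℝ × ℝ) :
    HasDerivAt (fun s : ℝ => cycleReal βL βR (q + s • d))
      (βL * βR / 2 * (d.1 * slopeNum βL βR q - d.2 * slopeDen βL βR q)) 0 := by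
  have h := ((hasDerivAt_moment_left 1 hq d).mul (hasDerivAt_moment_right 1 hq d)).const_mul
    (βL * βR)
  refine h.congr_deriv ?_
  norm_num [slopeNum, slopeDen]
  ring

theorem hasDerivAt_slopeNum {q : ℝ × ℝ} (hq : q ∈ smoothRegion βL βR) (d : ℝ × ℝ) :
    HasDerivAt (fun s : ℝ => slopeNum βL βR (q + s • d))
      ((1 / 2 * d.1 * moment 5 (βL - q.1) q.2 - d.2 * moment 2 (βL - q.1) q.2) *
          moment 1 (βR + q.1) q.2 +
        moment 3 (βL - q.1) q.2 *
          (-(1 / 2) * d.1 * moment 3 (βR + q.1) q.2 - d.2 * moment 0 (βR + q.1) q.2) -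
        ((1 / 2 * d.1 * moment 3 (βL - q.1) q.2 - d.2 * moment 0 (βL - q.1) q.2) *
          moment 3 (βR + q.1) q.2 +
        moment 1 (βL - q.1) q.2 *
          (-(1 / 2) * d.1 * moment 5 (βR + q.1) q.2 - d.2 * moment 2 (βR + q.1) q.2))) 0 := by
  have h := ((hasDerivAt_moment_left 3 hq d).mul (hasDerivAt_moment_right 1 hq d)).sub
    ((hasDerivAt_moment_left 1 hq d).mul (hasDerivAt_moment_right 3 hq d))
  refine h.congr_deriv ?_
  norm_num

theorem hasDerivAt_slopeDen {q : ℝ × ℝ} (hq : q ∈ smoothRegion βL βR) (d : ℝ × ℝ) :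
    HasDerivAt (fun s : ℝ => slopeDen βL βR (q + s • d))
      (2 * ((1 / 2 * d.1 * moment 2 (βL - q.1) q.2 - d.2 * moment (-1) (βL - q.1) q.2) *
          moment 1 (βR + q.1) q.2 +
        moment 0 (βL - q.1) q.2 *
          (-(1 / 2) * d.1 * moment 3 (βR + q.1) q.2 - d.2 * moment 0 (βR + q.1) q.2) +
        ((1 / 2 * d.1 * moment 3 (βL - q.1) q.2 - d.2 * moment 0 (βL - q.1) q.2) *
          moment 0 (βR + q.1) q.2 +
        moment 1 (βL - q.1) q.2 *
          (-(1 / 2) * d.1 * moment 2 (βR + q.1) q.2 - d.2 * moment (-1) (βR + q.1) q.2)))) 0 := by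
  have h := (((hasDerivAt_moment_left 0 hq d).mul (hasDerivAt_moment_right 1 hq d)).add
    ((hasDerivAt_moment_left 1 hq d).mul (hasDerivAt_moment_right 0 hq d))).const_mul 2
  refine h.congr_deriv ?_
  norm_num

/-- Write `N`, `D` for `slopeNum`, `slopeDen`. As `N = j D` at `q`, the derivative is `(N' - j
D')/D`, a positive multiple of the second derivative of the cycle transform in the direction `(1,
j)`, tangent to the level curve. -/
theorem slope_hessian_pos {q : ℝ × ℝ} (hq : q ∈ smoothRegion βL βR) {j : ℝ}
    (hj : slopeNum βL βR q / slopeDen βL βR q = j) :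
    ∃ r : ℝ, 0 < r ∧
      HasDerivAt (fun s : ℝ => slopeNum βL βR (q + s • (1, j)) / slopeDen βL βR (q + s • (1, j)))
        r 0 := by
  have hD := slopeDen_pos hq
  have hN : slopeNum βL βR q = j * slopeDen βL βR q := by rw [← hj]; field_simp
  have h1 := hasDerivAt_slopeNum hq (1, j)
  have h2 := hasDerivAt_slopeDen hq (1, j)
  have hz : q + (0 : ℝ) • ((1 : ℝ), j) = q := by simp
  have h := h1.div h2 (by rw [hz]; exact hD.ne')
  rw [hz, hN] at h
  refine ⟨_, ?_, h⟩
  have b1 : 0 < βL - q.1 := sub_pos.2 hq.1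
  have b2 : 0 < βR + q.1 := by linarith [hq.2.1]
  have c1 := sq_moment_lt (α := 1 / 2) (-j) b1 hq.2.2 (by norm_num)
  have c2 := sq_moment_lt (α := -(1 / 2)) (-j) b2 hq.2.2 (by norm_num)
  have p1 := moment_pos (a := 1) b1 hq.2.2
  have p2 := moment_pos (a := 1) b2 hq.2.2
  refine div_pos ?_ (by positivity)
  simp only
  generalize moment 1 (βL - q.1) q.2 = L1 at *
  generalize moment 1 (βR + q.1) q.2 = R1 at *
  generalize moment 3 (βL - q.1) q.2 = L3 at *
  generalize moment 3 (βR + q.1) q.2 = R3 at *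
  generalize moment 0 (βL - q.1) q.2 = L0 at *
  generalize moment 0 (βR + q.1) q.2 = R0 at *
  generalize moment 5 (βL - q.1) q.2 = L5 at *
  generalize moment 5 (βR + q.1) q.2 = R5 at *
  generalize moment 2 (βL - q.1) q.2 = L2 at *
  generalize moment 2 (βR + q.1) q.2 = R2 at *
  generalize moment (-1) (βL - q.1) q.2 = Ln at *
  generalize moment (-1) (βR + q.1) q.2 = Rn at *
  generalize slopeDen βL βR q = D at *
  -- Strict Cauchy–Schwarz at each wall bounds the second derivative, times `L1 * R1`, strictly
  -- below by the perfect square in `k3`.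
  have k1 := mul_lt_mul_of_pos_left c1 (show 0 < R1 ^ 2 by positivity)
  have k2 := mul_lt_mul_of_pos_left c2 (show 0 < L1 ^ 2 by positivity)
  have k3 := sq_nonneg (R1 * (1 / 2 * L3 + -j * L0) + L1 * (-(1 / 2) * R3 + -j * R0))
  have key : 0 < L1 * R1 * (R1 * ((1 / 2) ^ 2 * L5 + 2 * (1 / 2) * -j * L2 + (-j) ^ 2 * Ln) +
      L1 * ((-(1 / 2)) ^ 2 * R5 + 2 * -(1 / 2) * -j * R2 + (-j) ^ 2 * Rn) +
      2 * (1 / 2 * L3 + -j * L0) * (-(1 / 2) * R3 + -j * R0)) := by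
    nlinarith
  have key' := (mul_pos_iff_of_pos_left (mul_pos p1 p2)).1 key
  have := mul_pos hD key'
  nlinarith

/-- Jensen's inequality based at `q`: since the transform equals 1 at `q`, its tangent line there
supports the whole region. The first-order condition is thus sufficient for a global maximum. -/
theorem le_of_critical (hL : 0 < βL) (hR : 0 < βR) {q : ℝ × ℝ} (hq : q ∈ smoothRegion βL βR)
    (hc : cycleReal βL βR q = 1) {q' : ℝ × ℝ} (hq' : q' ∈ epigraph βL βR) :
    q'.1 * (slopeNum βL βR q / slopeDen βL βR q) - q'.2 ≤
      q.1 * (slopeNum βL βR q / slopeDen βL βR q) - q.2 := by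
  obtain ⟨h1, h2, h3⟩ := bounds_of_mem_epigraph hL hR hq'
  rw [mem_epigraph_iff hL hR h1 h2 h3] at hq'
  have b1 : 0 < βL - q.1 := sub_pos.2 hq.1
  have b2 : 0 < βR + q.1 := by linarith [hq.2.1]
  have hD := slopeDen_pos hq
  have k1 := moment_mul_exp_le b1 hq.2.2.le h1 h3
  have k2 := moment_mul_exp_le b2 hq.2.2.le h2 h3
  have p1 := moment_one_pos b1 hq.2.2.le
  have p2 := moment_one_pos b2 hq.2.2.le
  have k := mul_le_mul k1 k2 (by positivity) (moment_one_pos h1 h3).le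
  rw [mul_mul_mul_comm, ← Real.exp_add] at k
  have hexp := (mul_le_mul_of_nonneg_left k (mul_pos hL hR).le).trans hq'
  rw [← mul_assoc] at hexp
  rw [cycleReal] at hc
  rw [hc, one_mul, Real.exp_le_one_iff, div_add_div _ _ p1.ne' p2.ne', div_le_iff₀ (mul_pos p1 p2),
    zero_mul] at hexp
  rw [← sub_nonneg]
  have : 0 ≤ slopeDen βL βR q * (q.1 * (slopeNum βL βR q / slopeDen βL βR q) - q.2 -
      (q'.1 * (slopeNum βL βR q / slopeDen βL βR q) - q'.2)) := by
    have e : slopeDen βL βR q * (q.1 * (slopeNum βL βR q / slopeDen βL βR q) - q.2 -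
      (q'.1 * (slopeNum βL βR q / slopeDen βL βR q) - q'.2)) =
      (q.1 - q'.1) * slopeNum βL βR q - (q.2 - q'.2) * slopeDen βL βR q := by
      field_simp
      ring
    rw [e, slopeNum, slopeDen]
    linarith
  exact nonneg_of_mul_nonneg_right this hD

theorem not_isMaxOn_of_deriv_neg (hL : 0 < βL) (hR : 0 < βR) {q : ℝ × ℝ} {j : ℝ}
    (hq : q ∈ smoothRegion βL βR) (hq1 : cycleReal βL βR q ≤ 1) {d : ℝ × ℝ}
    (hd : 0 < d.1 * j - d.2)
    (hd' : d.1 * slopeNum βL βR q - d.2 * slopeDen βL βR q < 0) :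
    ∃ q' ∈ epigraph βL βR, q.1 * j - q.2 < q'.1 * j - q'.2 := by
  have h := hasDerivAt_cycleReal hq d
  have hneg : βL * βR / 2 * (d.1 * slopeNum βL βR q - d.2 * slopeDen βL βR q) < 0 :=
    mul_neg_of_pos_of_neg (by positivity) hd'
  have hz : q + (0 : ℝ) • d = q := by simp
  have hs := (hasDerivAt_iff_tendsto_slope.1 h).mono_left
        (nhdsWithin_mono 0 fun x (hx : x ∈ Set.Ioi 0) => ne_of_gt hx)
  have hcont : Tendsto (fun s : ℝ => q + s • d) (𝓝[>] 0) (𝓝 q) := by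
    have : Continuous fun s : ℝ => q + s • d := by fun_prop
    have := (this.tendsto 0).mono_left (nhdsWithin_le_nhds (s := Set.Ioi 0))
    rwa [hz] at this
  obtain ⟨s, ⟨hs1, hs2⟩, hs0⟩ := (((hs.eventually (gt_mem_nhds hneg)).and
    (hcont.eventually (isOpen_smoothRegion.mem_nhds hq))).and self_mem_nhdsWithin).exists
  have hs0 : 0 < s := hs0
  refine ⟨q + s • d, (mem_epigraph_iff_cycleReal_le hL hR hs2).2 ?_, ?_⟩
  · rw [slope_def_field, hz, sub_zero, div_lt_iff₀ hs0, zero_mul] at hs1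
    linarith
  · have := mul_pos hs0 hd
    simp only [Prod.fst_add, Prod.snd_add, Prod.smul_fst, Prod.smul_snd, smul_eq_mul]
    linarith

/-- The Lagrange condition. If the slope differed from `j`, a direction `±(1, s)` with `s` strictly
between them would increase the objective and decrease the transform. -/
theorem slope_eq_of_isMaxOn (hL : 0 < βL) (hR : 0 < βR) {q : ℝ × ℝ} {j : ℝ}
    (hq : q ∈ smoothRegion βL βR) (hq1 : q ∈ epigraph βL βR)
    (hmax : ∀ q' ∈ epigraph βL βR, q'.1 * j - q'.2 ≤ q.1 * j - q.2) :
    slopeNum βL βR q / slopeDen βL βR q = j := by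
  have hD := slopeDen_pos hq
  have hq1' := (mem_epigraph_iff_cycleReal_le hL hR hq).1 hq1
  rcases lt_trichotomy (slopeNum βL βR q / slopeDen βL βR q) j with h | h | h
  · obtain ⟨s, hs1, hs2⟩ := exists_between h
    rw [div_lt_iff₀ hD] at hs1
    obtain ⟨q', hq', hlt⟩ := not_isMaxOn_of_deriv_neg hL hR (j := j) hq hq1' (d := (1, s))
      (by simpa using hs2) (by simpa using hs1)
    exact absurd (hmax q' hq') (not_le.2 hlt)
  · exact h
  · obtain ⟨s, hs1, hs2⟩ := exists_between h
    rw [lt_div_iff₀ hD] at hs2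
    obtain ⟨q', hq', hlt⟩ := not_isMaxOn_of_deriv_neg hL hR (j := j) hq hq1' (d := (-1, -s))
      (by simpa using hs1) (by simp; linarith)
    exact absurd (hmax q' hq') (not_le.2 hlt)

/-- If the transform were below 1, `θ` could be lowered a little. -/
theorem cycleReal_eq_one_of_isMaxOn (hL : 0 < βL) (hR : 0 < βR) {q : ℝ × ℝ} {j : ℝ}
    (hq : q ∈ smoothRegion βL βR) (hq1 : q ∈ epigraph βL βR)
    (hmax : ∀ q' ∈ epigraph βL βR, q'.1 * j - q'.2 ≤ q.1 * j - q.2) :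
    cycleReal βL βR q = 1 := by
  have hq1' := (mem_epigraph_iff_cycleReal_le hL hR hq).1 hq1
  refine le_antisymm hq1' (not_lt.1 fun hlt => ?_)
  have hz : q + (0 : ℝ) • ((0 : ℝ), (-1 : ℝ)) = q := by simp
  have h := (hasDerivAt_cycleReal hq (0, -1)).continuousAt
  have h' : ContinuousAt (fun s : ℝ => q + s • ((0 : ℝ), (-1 : ℝ))) 0 := by fun_prop
  have e1 := h.eventually (gt_mem_nhds (by simpa [hz] using hlt))
  have e2 := h'.eventually (isOpen_smoothRegion.mem_nhds (by simpa [hz] using hq))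
  obtain ⟨s, ⟨hs1, hs2⟩, hs0⟩ := (((e1.and e2).filter_mono
    (nhdsWithin_le_nhds (s := Set.Ioi 0))).and self_mem_nhdsWithin).exists
  have hs0 : 0 < s := hs0
  have := hmax _ ((mem_epigraph_iff_cycleReal_le hL hR hs2).2 hs1.le)
  simp at this
  linarith

theorem exists_isMaxOn_smoothRegion (hL : 0 < βL) (hLR : βL ≤ βR) {j : ℝ}
    (hj : jStar βL βR < j) : ∃ q ∈ smoothRegion βL βR, q ∈ epigraph βL βR ∧
      ∀ q' ∈ epigraph βL βR, q'.1 * j - q'.2 ≤ q.1 * j - q.2 := by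
  have hR := hL.trans_le hLR
  have hj0 : 0 < j := (jStar_nonneg hL hLR).trans_lt hj
  obtain ⟨q, hq, hmax⟩ := exists_isMaxOn_epigraph hL hR j
  obtain ⟨q₁, hq₁, h₁⟩ := exists_mem_epigraph_lt hL hLR hj
  have hpos := h₁.trans_le (hmax q₁ hq₁)
  obtain ⟨h1, h2, h3⟩ := bounds_of_mem_epigraph hL hR hq
  have hq1 : 0 < q.1 := by
    by_contra h
    nlinarith
  refine ⟨q, ⟨by linarith, by linarith, lt_of_le_of_ne h3 fun h0 => ?_⟩, hq, hmax⟩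
  -- On the edge `θ = 0` membership reads `β_L β_R ≤ (β_L - λ)(β_R + λ)`, that is `λ (β_L - β_R - λ)
  -- ≥ 0`, impossible for `λ > 0` since `β_L ≤ β_R`.
  rw [mem_epigraph_iff hL hR h1 h2 h3, ← h0, moment_one_zero h1, moment_one_zero h2] at hq
  have : βL * βR * (1 / (βL - q.1) * (1 / (βR + q.1))) =
    βL * βR / ((βL - q.1) * (βR + q.1)) := by field_simp
  rw [this, div_le_one (by positivity)] at hq
  nlinarith

/-! ### Smoothness beyond `j*` by the inverse function theorem -/

theorem contDiffOn_moment_left (a : ℤ) : ContDiffOn ℝ (⊤ : ℕ∞)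
    (fun q : ℝ × ℝ => moment a (βL - q.1) q.2) (smoothRegion βL βR) :=
  (contDiffOn_moment a).comp (g := fun q : ℝ × ℝ => moment a q.1 q.2)
    (f := fun q : ℝ × ℝ => (βL - q.1, q.2)) (by fun_prop)
    fun _ hq => ⟨sub_pos.2 hq.1, hq.2.2⟩

theorem contDiffOn_moment_right (a : ℤ) : ContDiffOn ℝ (⊤ : ℕ∞)
    (fun q : ℝ × ℝ => moment a (βR + q.1) q.2) (smoothRegion βL βR) :=
  (contDiffOn_moment a).comp (g := fun q : ℝ × ℝ => moment a q.1 q.2)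
    (f := fun q : ℝ × ℝ => (βR + q.1, q.2)) (by fun_prop)
    fun q hq => ⟨show 0 < βR + q.1 by linarith [hq.2.1], hq.2.2⟩

theorem contDiffOn_cycleReal :
    ContDiffOn ℝ (⊤ : ℕ∞) (cycleReal βL βR) (smoothRegion βL βR) :=
  contDiffOn_const.mul ((contDiffOn_moment_left 1).mul (contDiffOn_moment_right 1))

theorem contDiffOn_slope : ContDiffOn ℝ (⊤ : ℕ∞)
    (fun q => slopeNum βL βR q / slopeDen βL βR q) (smoothRegion βL βR) :=
  (((contDiffOn_moment_left 3).mul (contDiffOn_moment_right 1)).sub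
    ((contDiffOn_moment_left 1).mul (contDiffOn_moment_right 3))).div
  (contDiffOn_const.mul (((contDiffOn_moment_left 0).mul (contDiffOn_moment_right 1)).add
    ((contDiffOn_moment_left 1).mul (contDiffOn_moment_right 0))))
  fun _ hq => (slopeDen_pos hq).ne'

theorem fderiv_apply_of_hasDerivAt_line {f : ℝ × ℝ → ℝ} {q d : ℝ × ℝ} {c : ℝ}
    (hf : DifferentiableAt ℝ f q) (h : HasDerivAt (fun s : ℝ => f (q + s • d)) c 0) :
    fderiv ℝ f q d = c := by
  have h1 : HasDerivAt (fun s : ℝ => q + s • d) d 0 := by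
    simpa using ((hasDerivAt_id (0 : ℝ)).smul_const d).const_add q
  have h2 : HasFDerivAt f (fderiv ℝ f q) (q + (0 : ℝ) • d) := by simpa using hf.hasFDerivAt
  exact (h2.comp_hasDerivAt (0 : ℝ) h1).unique h

/-- The map (transform, slope) is a local diffeomorphism at the maximiser `q`. Its inverse along
`(1, x)`, `x` near `j`, is a smooth curve of critical points; `le_of_critical` makes them
maximisers, so `rate` is a smooth expression in them. -/
theorem contDiffAt_rate (hL : 0 < βL) (hLR : βL ≤ βR) {j : ℝ} (hj : jStar βL βR < j) :
    ContDiffAt ℝ (⊤ : ℕ∞) (rate βL βR) j := by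
  have hR := hL.trans_le hLR
  obtain ⟨q, hq, hqe, hmax⟩ := exists_isMaxOn_smoothRegion hL hLR hj
  have hr := slope_eq_of_isMaxOn hL hR hq hqe hmax
  have hc := cycleReal_eq_one_of_isMaxOn hL hR hq hqe hmax
  have hD := slopeDen_pos hq
  have hnhds := isOpen_smoothRegion.mem_nhds hq
  set r : ℝ × ℝ → ℝ := fun q => slopeNum βL βR q / slopeDen βL βR q with hrdef
  have sc : ContDiffAt ℝ (⊤ : ℕ∞) (cycleReal βL βR) q := contDiffOn_cycleReal.contDiffAt hnhds
  have sr : ContDiffAt ℝ (⊤ : ℕ∞) r q := contDiffOn_slope.contDiffAt hnhds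
  have hne : ((⊤ : ℕ∞) : WithTop ℕ∞) ≠ 0 := by simp
  have dc := sc.differentiableAt hne
  have dr := sr.differentiableAt hne
  set G : ℝ × ℝ → ℝ × ℝ := fun q => (cycleReal βL βR q, r q) with hG
  have sG : ContDiffAt ℝ (⊤ : ℕ∞) G q := sc.prodMk sr
  set T := (fderiv ℝ (cycleReal βL βR) q).prod (fderiv ℝ r q) with hT
  have hGT : HasFDerivAt G T q := dc.hasFDerivAt.prodMk dr.hasFDerivAt
  -- The kernel of the transform's differential is spanned by `(1, j)`, on which the slope's
  -- differential is nonzero by `slope_hessian_pos`.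
  have hinj : Function.Injective T := by
    refine (injective_iff_map_eq_zero T).2 fun v hv => ?_
    obtain ⟨hv1, hv2⟩ := Prod.ext_iff.1 hv
    have hv1 : fderiv ℝ (cycleReal βL βR) q v = 0 := hv1
    have hv2 : fderiv ℝ r q v = 0 := hv2
    rw [fderiv_apply_of_hasDerivAt_line dc (hasDerivAt_cycleReal hq v)] at hv1
    have hN : slopeNum βL βR q = j * slopeDen βL βR q := by rw [← hr]; field_simp
    have hv3 : v.2 = v.1 * j := by
      have : βL * βR / 2 ≠ 0 := by positivity
      have := (mul_eq_zero.1 hv1).resolve_left this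
      rw [hN] at this
      have : (v.1 * j - v.2) * slopeDen βL βR q = 0 := by linarith
      linarith [(mul_eq_zero.1 this).resolve_right hD.ne']
    have hv4 : v = v.1 • (1, j) := by ext <;> simp [hv3]
    obtain ⟨c, hc0, hc⟩ := slope_hessian_pos hq hr
    rw [hv4, map_smul, fderiv_apply_of_hasDerivAt_line dr hc, smul_eq_mul] at hv2
    rw [hv4, (mul_eq_zero.1 hv2).resolve_right hc0.ne', zero_smul]
  let e : (ℝ × ℝ) ≃L[ℝ] (ℝ × ℝ) :=
    (LinearEquiv.ofInjectiveEndo (T : (ℝ × ℝ) →ₗ[ℝ] (ℝ × ℝ)) hinj).toContinuousLinearEquiv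
  have heT : (e : (ℝ × ℝ) →L[ℝ] (ℝ × ℝ)) = T := by ext <;> rfl
  have hGe : HasFDerivAt G (e : (ℝ × ℝ) →L[ℝ] (ℝ × ℝ)) q := by rw [heT]; exact hGT
  have hstrict := sG.hasStrictFDerivAt' hGe hne
  set ψ := sG.localInverse hGe hne with hψ
  have hGq : G q = (1, j) := by simp only [hG]; rw [hc, ← hr]
  have hψs : ContDiffAt ℝ (⊤ : ℕ∞) ψ (1, j) := by
    rw [← hGq]; exact sG.to_localInverse hGe hne
  have hψq : ψ (1, j) = q := by rw [← hGq]; exact sG.localInverse_apply_image hGe hne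
  have hline : ContDiffAt ℝ (⊤ : ℕ∞) (fun x : ℝ => ψ (1, x)) j :=
    hψs.comp j (contDiffAt_const.prodMk contDiffAt_id)
  have hright : ∀ᶠ y in 𝓝 (1, j), G (ψ y) = y := by
    have := hstrict.eventually_right_inverse
    rwa [hGq] at this
  have hx : Tendsto (fun x : ℝ => ((1 : ℝ), x)) (𝓝 j) (𝓝 (1, j)) :=
    (by fun_prop : Continuous fun x : ℝ => ((1 : ℝ), x)).tendsto j
  have hmem : ∀ᶠ x in 𝓝 j, ψ (1, x) ∈ smoothRegion βL βR :=
    hline.continuousAt.eventually (isOpen_smoothRegion.mem_nhds (by simpa only [hψq] using hq))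
  have hform : (fun x => (ψ (1, x)).1 * x - (ψ (1, x)).2) =ᶠ[𝓝 j] rate βL βR := by
    filter_upwards [hmem, hx.eventually hright] with x hx1 hx2
    obtain ⟨e1, e2⟩ := Prod.ext_iff.1 hx2
    have e1 : cycleReal βL βR (ψ (1, x)) = 1 := e1
    have e2 : slopeNum βL βR (ψ (1, x)) / slopeDen βL βR (ψ (1, x)) = x := e2
    symm
    refine rate_eq_of_isMaxOn ((mem_epigraph_iff_cycleReal_le hL hR hx1).2 e1.le) fun q' hq' => ?_
    have := le_of_critical hL hR hx1 e1 hq'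
    rwa [e2] at this
  refine ContDiffAt.congr_of_eventuallyEq ?_ hform.symm
  exact (hline.fst.mul contDiffAt_id).sub hline.snd

theorem contDiffOn_rate (hL : 0 < βL) (hLR : βL ≤ βR) :
    ContDiffOn ℝ (⊤ : ℕ∞) (rate βL βR) (Set.Icc (-jStar βL βR) (jStar βL βR))ᶜ := by
  intro j hj
  refine ContDiffAt.contDiffWithinAt ?_
  rw [Set.mem_compl_iff, Set.mem_Icc, not_and_or, not_le, not_le] at hj
  rcases hj with hj | hj
  · have h := contDiffAt_rate hL hLR (j := -j) (by linarith)
    have e : rate βL βR = fun j => (βL - βR) * j + rate βL βR (-j) :=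
      funext (rate_reflect hL (hL.trans_le hLR))
    rw [e]
    exact (contDiffAt_const.mul contDiffAt_id).add (h.comp j contDiffAt_id.neg)
  · exact contDiffAt_rate hL hLR hj

/-! ### Strict convexity -/

/-- In case of equality the maximiser at `a x + b y` is also one at `x` and at `y`; its slope would
equal both. -/
theorem rate_lt_of_jStar_lt (hL : 0 < βL) (hLR : βL ≤ βR) {x y a b : ℝ} (hxy : x ≠ y)
    (ha : 0 < a) (hb : 0 < b) (hab : a + b = 1) (hj : jStar βL βR < a * x + b * y) :
    rate βL βR (a * x + b * y) < a * rate βL βR x + b * rate βL βR y := by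
  have hR := hL.trans_le hLR
  obtain ⟨q, hq, hqe, hmax⟩ := exists_isMaxOn_smoothRegion hL hLR hj
  have hx := le_rate hL hR hqe x
  have hy := le_rate hL hR hqe y
  by_contra hcon
  rw [rate_eq_of_isMaxOn hqe hmax, not_lt] at hcon
  have e : q.2 = a * q.2 + b * q.2 := by rw [← add_mul, hab, one_mul]
  have hx1 := mul_le_mul_of_nonneg_left hx ha.le
  have hy1 := mul_le_mul_of_nonneg_left hy hb.le
  have hx2 : rate βL βR x = q.1 * x - q.2 :=
    le_antisymm (le_of_mul_le_mul_left (by linarith) ha) hx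
  have hy2 : rate βL βR y = q.1 * y - q.2 :=
    le_antisymm (le_of_mul_le_mul_left (by linarith) hb) hy
  refine hxy ?_
  have sx := slope_eq_of_isMaxOn hL hR hq hqe fun q' hq' => hx2 ▸ le_rate hL hR hq' x
  have sy := slope_eq_of_isMaxOn hL hR hq hqe fun q' hq' => hy2 ▸ le_rate hL hR hq' y
  exact sx.symm.trans sy

/-- The combination may land in the flat part `[0, j*]`. Then one of `x`, `y` exceeds `j*`, where
`rate` is positive, because two points below `-j*` cannot average to a nonnegative number. -/
theorem rate_lt_of_nonneg (hL : 0 < βL) (hLR : βL ≤ βR) {x y a b : ℝ} (hxy : x ≠ y)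
    (hx : x ∈ (Set.Icc (-jStar βL βR) (jStar βL βR))ᶜ)
    (hy : y ∈ (Set.Icc (-jStar βL βR) (jStar βL βR))ᶜ)
    (ha : 0 < a) (hb : 0 < b) (hab : a + b = 1) (h0 : 0 ≤ a * x + b * y) :
    rate βL βR (a * x + b * y) < a * rate βL βR x + b * rate βL βR y := by
  have hR := hL.trans_le hLR
  rcases lt_or_ge (jStar βL βR) (a * x + b * y) with h | h
  · exact rate_lt_of_jStar_lt hL hLR hxy ha hb hab h
  · rw [rate_eq_zero hL hR ⟨h0, h⟩]
    have hs := jStar_nonneg hL hLR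
    have hx0 := mul_nonneg ha.le (rate_nonneg hL hR x)
    have hy0 := mul_nonneg hb.le (rate_nonneg hL hR y)
    rw [Set.mem_compl_iff, Set.mem_Icc, not_and_or, not_le, not_le] at hx hy
    rcases hx with hx | hx
    · rcases hy with hy | hy
      · nlinarith
      · have := mul_pos hb (rate_pos hL hLR hy)
        linarith
    · have := mul_pos ha (rate_pos hL hLR hx)
      linarith

theorem rate_lt (hL : 0 < βL) (hLR : βL ≤ βR) {x y a b : ℝ} (hxy : x ≠ y)
    (hx : x ∈ (Set.Icc (-jStar βL βR) (jStar βL βR))ᶜ)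
    (hy : y ∈ (Set.Icc (-jStar βL βR) (jStar βL βR))ᶜ)
    (ha : 0 < a) (hb : 0 < b) (hab : a + b = 1) :
    rate βL βR (a * x + b * y) < a * rate βL βR x + b * rate βL βR y := by
  have hR := hL.trans_le hLR
  rcases le_total 0 (a * x + b * y) with h | h
  · exact rate_lt_of_nonneg hL hLR hxy hx hy ha hb hab h
  · have hneg : ∀ z, z ∈ (Set.Icc (-jStar βL βR) (jStar βL βR))ᶜ →
        -z ∈ (Set.Icc (-jStar βL βR) (jStar βL βR))ᶜ := by
      rintro z hz ⟨h1, h2⟩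
      exact hz ⟨by linarith, by linarith⟩
    have := rate_lt_of_nonneg hL hLR (x := -x) (y := -y) (by simpa using hxy) (hneg x hx)
      (hneg y hy) ha hb hab (by linarith)
    rw [rate_reflect hL hR (a * x + b * y), rate_reflect hL hR x, rate_reflect hL hR y]
    rw [show a * -x + b * -y = -(a * x + b * y) by ring] at this
    linarith

/-! ### Conditioning on the first flight -/

/-- The sequence `x, v 0, v 1, …`. -/
def consSeq (x : ℝ) (v : ℕ → ℝ) : ℕ → ℝ
  | 0 => x
  | n + 1 => v n

theorem measurable_consSeq : Measurable fun z : ℝ × (ℕ → ℝ) => consSeq z.1 z.2 := by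
  refine measurable_pi_iff.2 fun n => ?_
  cases n with
  | zero => exact measurable_fst
  | succ n => exact (measurable_pi_apply n).comp measurable_snd

theorem wallSign_succ (p : ℝ) (k : ℕ) : wallSign p (k + 1) = wallSign (-p) k := by
  rw [wallSign, wallSign, pow_succ, Real.sign_neg]
  ring

theorem wallSign_zero (p : ℝ) : wallSign p 0 = Real.sign p := by simp [wallSign]

theorem wallSign_sq {p : ℝ} (hp : p ≠ 0) (k : ℕ) : wallSign p k ^ 2 = 1 := by
  rw [wallSign, mul_pow, ← pow_mul, mul_comm k, pow_mul]
  rcases Real.sign_apply_eq_of_ne_zero p hp with h | h <;> simp [h]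

theorem wallBeta_pos (hL : 0 < βL) (hR : 0 < βR) (s : ℝ) : 0 < wallBeta βL βR s := by
  rw [wallBeta]
  split_ifs <;> assumption

/-- The law of the speed at which the particle leaves the wall it hits with momentum `p`. -/
def emissionLaw (βL βR p : ℝ) : Measure ℝ := wallLaw (wallBeta βL βR (Real.sign p))

theorem isProbabilityMeasure_emissionLaw (hL : 0 < βL) (hR : 0 < βR) (p : ℝ) :
    IsProbabilityMeasure (emissionLaw βL βR p) :=
  isProbabilityMeasure_wallLaw (wallBeta_pos hL hR _)

theorem isProbabilityMeasure_speedLaw (hL : 0 < βL) (hR : 0 < βR) (p : ℝ) :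
    IsProbabilityMeasure (speedLaw βL βR p) := by
  have : ∀ k, IsProbabilityMeasure (wallLaw (wallBeta βL βR (wallSign p k))) :=
    fun k => isProbabilityMeasure_wallLaw (wallBeta_pos hL hR _)
  rw [speedLaw]
  infer_instance

/-- The renewal structure: after the first emission the motion restarts from the opposite wall,
which is encoded by `-p`. -/
theorem map_consSeq_prod (hL : 0 < βL) (hR : 0 < βR) (p : ℝ) :
    ((emissionLaw βL βR p).prod (speedLaw βL βR (-p))).map (fun z => consSeq z.1 z.2) =
      speedLaw βL βR p := by
  have hpr : ∀ p k, IsProbabilityMeasure (wallLaw (wallBeta βL βR (wallSign p k))) :=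
    fun p k => isProbabilityMeasure_wallLaw (wallBeta_pos hL hR _)
  have := hpr p
  have := hpr (-p)
  have := isProbabilityMeasure_emissionLaw hL hR p
  have := isProbabilityMeasure_speedLaw hL hR (-p)
  refine Measure.eq_infinitePi _ fun s t ht => ?_
  classical
  obtain ⟨N, hN⟩ : ∃ N, s ⊆ Finset.range (N + 1) :=
    ⟨s.sup id, fun i hi => Finset.mem_range_succ_iff.2 (Finset.le_sup (f := id) hi)⟩
  -- Padding with `univ` turns the cylinder into one over an initial segment of indices, whose
  -- preimage splits off coordinate 0.
  set t' : ℕ → Set ℝ := fun i => if i ∈ s then t i else Set.univ with ht'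
  have hm : ∀ i, MeasurableSet (t' i) := fun i => by
    simp only [ht']
    split_ifs
    exacts [ht i, MeasurableSet.univ]
  have e1 : (s : Set ℕ).pi t = (Finset.range (N + 1) : Set ℕ).pi t' := by
    ext u
    simp only [Set.mem_pi, Finset.mem_coe, ht']
    constructor
    · intro h i _
      by_cases hi : i ∈ s
      · simpa [hi] using h i hi
      · simp [hi]
    · intro h i hi
      simpa [hi] using h i (hN hi)
  have e2 : ∏ i ∈ s, wallLaw (wallBeta βL βR (wallSign p i)) (t i) =
      ∏ i ∈ Finset.range (N + 1), wallLaw (wallBeta βL βR (wallSign p i)) (t' i) := by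
    rw [← Finset.prod_subset hN]
    · refine Finset.prod_congr rfl fun i hi => by simp [ht', hi]
    · intro i _ hi
      simp [ht', hi]
  have e3 : (fun z : ℝ × (ℕ → ℝ) => consSeq z.1 z.2) ⁻¹' (Finset.range (N + 1) : Set ℕ).pi t' =
      t' 0 ×ˢ (Finset.range N : Set ℕ).pi fun i => t' (i + 1) := by
    ext z
    simp only [Set.mem_preimage, Set.mem_pi, Finset.mem_coe, Finset.mem_range, Set.mem_prod]
    constructor
    · intro h
      exact ⟨h 0 (by omega), fun i hi => h (i + 1) (by omega)⟩
    · rintro ⟨h0, h⟩ i hi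
      cases i with
      | zero => exact h0
      | succ i => exact h i (by omega)
  rw [e2, e1, Measure.map_apply measurable_consSeq
    (MeasurableSet.pi (Finset.countable_toSet _) fun i _ => hm i), e3, Measure.prod_prod,
    Finset.prod_range_succ', speedLaw, Measure.infinitePi_pi _ fun i _ => hm _, mul_comm,
    wallSign_zero]
  simp only [wallSign_succ]
  rfl

theorem lintegral_speedLaw (hL : 0 < βL) (hR : 0 < βR) (p : ℝ) {f : (ℕ → ℝ) → ENNReal}
    (hf : Measurable f) : ∫⁻ u, f u ∂speedLaw βL βR p =
      ∫⁻ x, ∫⁻ v, f (consSeq x v) ∂speedLaw βL βR (-p) ∂emissionLaw βL βR p := by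
  have := isProbabilityMeasure_speedLaw hL hR (-p)
  rw [← map_consSeq_prod hL hR p, lintegral_map hf measurable_consSeq]
  exact lintegral_prod _ (hf.comp measurable_consSeq).aemeasurable

theorem lintegral_wallLaw {β : ℝ} {f : ℝ → ENNReal} (hf : Measurable f) :
    ∫⁻ x, f x ∂wallLaw β =
      ∫⁻ x in Set.Ioi (0 : ℝ), ENNReal.ofReal (β * x * Real.exp (-β * x ^ 2 / 2)) * f x := by
  have hm : Measurable fun p => ENNReal.ofReal (wallDensity β p) := by
    unfold wallDensity
    refine ENNReal.measurable_ofReal.comp (Measurable.ite measurableSet_Ioi ?_ measurable_const)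
    fun_prop
  rw [wallLaw, lintegral_withDensity_eq_lintegral_mul _ hm hf, ← lintegral_indicator
    measurableSet_Ioi]
  refine lintegral_congr fun x => ?_
  by_cases hx : 0 < x
  · simp [wallDensity, hx]
  · simp [wallDensity, hx]

theorem wallLaw_Ioi (β : ℝ) : ∀ᵐ x ∂wallLaw β, 0 < x := by
  rw [ae_iff, ← lintegral_indicator_one (by measurability),
    lintegral_wallLaw (measurable_one.indicator (by measurability))]
  rw [setLIntegral_congr_fun measurableSet_Ioi (g := fun _ => 0)]
  · simp
  · intro x hx
    have hx : 0 < x := hx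
    simp [hx]

theorem wallLaw_Ioo_pos {β : ℝ} (hβ : 0 < β) {c : ℝ} (hc : 0 < c) :
    0 < wallLaw β (Set.Ioo 0 c) := by
  rw [← lintegral_indicator_one measurableSet_Ioo,
    lintegral_wallLaw (measurable_one.indicator measurableSet_Ioo)]
  rw [setLIntegral_pos_iff (by
    refine Measurable.mul (by fun_prop) (measurable_one.indicator measurableSet_Ioo))]
  have : Set.Ioo 0 c ⊆ (Function.support fun x : ℝ =>
      ENNReal.ofReal (β * x * Real.exp (-β * x ^ 2 / 2)) *
        (Set.Ioo 0 c).indicator (1 : ℝ → ENNReal) x) ∩ Set.Ioi 0 := by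
    intro x hx
    refine ⟨?_, hx.1⟩
    have := hx.1
    simp only [Function.mem_support, Set.indicator_of_mem hx, Pi.one_apply, mul_one, ne_eq,
      ENNReal.ofReal_eq_zero, not_le]
    positivity
  refine lt_of_lt_of_le ?_ (measure_mono this)
  simpa using hc

/-! ### Exponential moments over successive flights -/

/-- The exponential moment `E e^{λ ΔJ - θ Δt}` over one flight. -/
def flightMass (βL βR l θ p : ℝ) : ENNReal :=
  ∫⁻ x, ENNReal.ofReal (Real.exp (l / 2 * (x ^ 2 * -Real.sign p) - θ * (1 / x)))
    ∂emissionLaw βL βR p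

theorem lintegral_exp_wallLaw {β : ℝ} (hβ : 0 < β) (a θ : ℝ) :
    ∫⁻ x, ENNReal.ofReal (Real.exp (a / 2 * x ^ 2 - θ * (1 / x))) ∂wallLaw β =
      ENNReal.ofReal β * mass (β - a) θ := by
  rw [lintegral_wallLaw (by fun_prop), mass, ← lintegral_const_mul' _ _ ENNReal.ofReal_ne_top]
  refine setLIntegral_congr_fun measurableSet_Ioi fun x hx => ?_
  have hx : 0 < x := hx
  rw [← ENNReal.ofReal_mul (by positivity), ← ENNReal.ofReal_mul hβ.le, mul_assoc, ← Real.exp_add]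
  ring_nf

theorem flightMass_of_neg (hL : 0 < βL) (l θ : ℝ) {p : ℝ} (hp : p < 0) :
    flightMass βL βR l θ p = ENNReal.ofReal βL * mass (βL - l) θ := by
  rw [← lintegral_exp_wallLaw hL, flightMass, emissionLaw, Real.sign_of_neg hp, wallBeta,
    if_pos (by norm_num)]
  simp

theorem flightMass_of_pos (hR : 0 < βR) (l θ : ℝ) {p : ℝ} (hp : 0 < p) :
    flightMass βL βR l θ p = ENNReal.ofReal βR * mass (βR + l) θ := by
  rw [← sub_neg_eq_add, ← lintegral_exp_wallLaw hR, flightMass, emissionLaw, Real.sign_of_pos hp,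
    wallBeta, if_neg (by norm_num)]
  refine lintegral_congr fun x => ?_
  ring_nf

theorem flightMass_mul (hL : 0 < βL) (hR : 0 < βR) (l θ : ℝ) {p : ℝ} (hp : p ≠ 0) :
    flightMass βL βR l θ p * flightMass βL βR l θ (-p) = cycleMass βL βR l θ := by
  rw [cycleMass, ENNReal.ofReal_mul hL.le]
  rcases hp.lt_or_gt with h | h
  · rw [flightMass_of_neg hL l θ h, flightMass_of_pos hR l θ (neg_pos.2 h)]
    ring
  · rw [flightMass_of_pos hR l θ h, flightMass_of_neg hL l θ (neg_neg_iff_pos.2 h)]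
    ring

theorem flightMass_pos (hL : 0 < βL) (hR : 0 < βR) (l θ : ℝ) {p : ℝ} (hp : p ≠ 0) :
    0 < flightMass βL βR l θ p := by
  rcases hp.lt_or_gt with h | h
  · rw [flightMass_of_neg hL l θ h]
    exact ENNReal.mul_pos (by simpa using hL) (mass_pos _ _).ne'
  · rw [flightMass_of_pos hR l θ h]
    exact ENNReal.mul_pos (by simpa using hR) (mass_pos _ _).ne'

/-- The time spent in the first `n` flights. -/
def flightTime (n : ℕ) (u : ℕ → ℝ) : ℝ := ∑ i ∈ Finset.range n, 1 / u i

/-- `λ` times the energy exchanged in the first `n` flights. -/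
def flightEnergy (l p : ℝ) (n : ℕ) (u : ℕ → ℝ) : ℝ :=
  l / 2 * ∑ k ∈ Finset.range n, u k ^ 2 * wallSign p (k + 1)

theorem flightTime_consSeq (n : ℕ) (x : ℝ) (v : ℕ → ℝ) :
    flightTime (n + 1) (consSeq x v) = flightTime n v + 1 / x := by
  simp [flightTime, Finset.sum_range_succ', consSeq]

theorem flightEnergy_consSeq (l p : ℝ) (n : ℕ) (x : ℝ) (v : ℕ → ℝ) :
    flightEnergy l p (n + 1) (consSeq x v) =
      flightEnergy l (-p) n v + l / 2 * (x ^ 2 * -Real.sign p) := by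
  simp only [flightEnergy, Finset.sum_range_succ', consSeq, wallSign_succ, wallSign_zero,
    Real.sign_neg]
  ring

@[fun_prop]
theorem measurable_flightTime (n : ℕ) : Measurable (flightTime n) := by
  unfold flightTime
  fun_prop

@[fun_prop]
theorem measurable_flightEnergy (l p : ℝ) (n : ℕ) : Measurable (flightEnergy l p n) := by
  unfold flightEnergy
  fun_prop

theorem lintegral_exp_flight_succ (hL : 0 < βL) (hR : 0 < βR) (l θ p : ℝ) (n : ℕ) :
    ∫⁻ u, ENNReal.ofReal (Real.exp (flightEnergy l p (n + 1) u - θ * flightTime (n + 1) u))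
        ∂speedLaw βL βR p =
      flightMass βL βR l θ p *
      ∫⁻ u, ENNReal.ofReal (Real.exp (flightEnergy l (-p) n u - θ * flightTime n u))
        ∂speedLaw βL βR (-p) := by
  rw [lintegral_speedLaw hL hR p (by fun_prop), flightMass, ← lintegral_mul_const _ (by fun_prop)]
  refine lintegral_congr fun x => ?_
  rw [← lintegral_const_mul' _ _ ENNReal.ofReal_ne_top]
  refine lintegral_congr fun v => ?_
  rw [← ENNReal.ofReal_mul (Real.exp_pos _).le, ← Real.exp_add, flightEnergy_consSeq,
    flightTime_consSeq]
  ring_nf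

/-- The solution is `a = (1 + x) S`, `b = (1 + y) S` with `S = ∑ (x y)^n`. It bounds the Chernoff
sums started from the two walls, which feed into each other with factors `x` and `y`. -/
theorem exists_ne_top_ge_one_add_mul {x y : ENNReal} (hxy : x * y < 1) (hx : x ≠ 0) (hy : y ≠ 0) :
    ∃ a b : ENNReal, a ≠ ⊤ ∧ 1 + x * b = a ∧ 1 + y * a = b := by
  have hx' : x ≠ ⊤ := fun h => by rw [h, ENNReal.top_mul hy] at hxy; simp at hxy
  have hy' : y ≠ ⊤ := fun h => by rw [h, ENNReal.mul_top hx] at hxy; simp at hxy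
  set S := ∑' n : ℕ, (x * y) ^ n with hS
  have hS1 : S = 1 + x * y * S := by
    rw [hS, ← ENNReal.tsum_mul_left]
    simp only [← pow_succ']
    rw [tsum_eq_zero_add' ENNReal.summable, pow_zero]
  have hSf : S ≠ ⊤ := by
    rw [hS, ENNReal.tsum_geometric]
    simpa [tsub_eq_zero_iff_le] using hxy
  refine ⟨(1 + x) * S, (1 + y) * S, ENNReal.mul_ne_top (by simpa using hx') hSf, ?_, ?_⟩
  · calc _ = (1 + x * y * S) + x * S := by ring
      _ = _ := by rw [← hS1]; ring
  · calc _ = (1 + x * y * S) + y * S := by ring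
      _ = _ := by rw [← hS1]; ring

theorem tsum_lintegral_exp_flight_ne_top (hL : 0 < βL) (hR : 0 < βR) {l θ p : ℝ} (hp : p ≠ 0)
    (h : cycleMass βL βR l θ < 1) :
    ∑' n, ∫⁻ u, ENNReal.ofReal (Real.exp (flightEnergy l p n u - θ * flightTime n u))
        ∂speedLaw βL βR p ≠ ⊤ := by
  rw [← flightMass_mul hL hR l θ hp] at h
  obtain ⟨a, b, ha, hab, hba⟩ := exists_ne_top_ge_one_add_mul h (flightMass_pos hL hR l θ hp).ne'
    (flightMass_pos hL hR l θ (neg_ne_zero.2 hp)).ne'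
  have h0 : ∀ p, ∫⁻ u, ENNReal.ofReal (Real.exp (flightEnergy l p 0 u - θ * flightTime 0 u))
        ∂speedLaw βL βR p = 1 := fun p => by
    have := isProbabilityMeasure_speedLaw hL hR p
    simp [flightEnergy, flightTime]
  have key : ∀ N : ℕ,
      ∑ n ∈ Finset.range N, ∫⁻ u, ENNReal.ofReal (Real.exp (flightEnergy l p n u -
        θ * flightTime n u)) ∂speedLaw βL βR p ≤ a ∧
      ∑ n ∈ Finset.range N, ∫⁻ u, ENNReal.ofReal (Real.exp (flightEnergy l (-p) n u -
        θ * flightTime n u)) ∂speedLaw βL βR (-p) ≤ b := by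
    intro N
    induction N with
    | zero => simp
    | succ N ih =>
      rw [Finset.sum_range_succ', Finset.sum_range_succ', h0, h0]
      simp only [lintegral_exp_flight_succ hL hR, neg_neg]
      rw [← Finset.mul_sum, ← Finset.mul_sum, add_comm, ← hab, add_comm _ 1]
      refine ⟨by gcongr; exact ih.2, ?_⟩
      rw [← hba]
      gcongr
      exact ih.1
  exact ne_top_of_le_ne_top ha (ENNReal.tsum_le_of_sum_range_le fun N => (key N).1)

theorem ae_pos_speedLaw (hL : 0 < βL) (hR : 0 < βR) (p : ℝ) :
    ∀ᵐ u ∂speedLaw βL βR p, ∀ k, 0 < u k := by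
  have : ∀ k, IsProbabilityMeasure (wallLaw (wallBeta βL βR (wallSign p k))) :=
    fun k => isProbabilityMeasure_wallLaw (wallBeta_pos hL hR _)
  refine ae_all_iff.2 fun k => ?_
  exact (measurePreserving_eval_infinitePi
    (fun k => wallLaw (wallBeta βL βR (wallSign p k))) k).quasiMeasurePreserving.ae
    (wallLaw_Ioi _)

/-- No explosion: at `λ = 0`, `θ = 1` the cycle transform is below 1, so `∑ e^{-flightTime n}` has
finite expectation and its terms tend to 0 almost surely. -/
theorem ae_exists_lt_flightTime (hL : 0 < βL) (hR : 0 < βR) {p : ℝ} (hp : p ≠ 0) :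
    ∀ᵐ u ∂speedLaw βL βR p, ∀ t : ℝ, ∃ n, t < flightTime n u := by
  have h0 : cycleMass βL βR 0 0 ≤ 1 := zero_mem_epigraph hL hR
  have h1 : cycleMass βL βR 0 1 < 1 := (cycleMass_strictAnti hL hR zero_lt_one
    (ne_top_of_le_ne_top ENNReal.one_ne_top h0)).trans_le h0
  have h2 := tsum_lintegral_exp_flight_ne_top hL hR hp h1
  rw [← lintegral_tsum fun n => Measurable.aemeasurable (by fun_prop)] at h2
  filter_upwards [ae_lt_top (Measurable.tsum fun n => by fun_prop) h2] with u hu t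
  have := ENNReal.tendsto_atTop_zero_of_tsum_ne_top hu.ne
  obtain ⟨n, hn⟩ := (this.eventually (gt_mem_nhds
    (show (0 : ENNReal) < ENNReal.ofReal (Real.exp (-t)) by simpa using Real.exp_pos _))).exists
  refine ⟨n, ?_⟩
  rw [ENNReal.ofReal_lt_ofReal_iff (Real.exp_pos _), Real.exp_lt_exp] at hn
  simp only [flightEnergy, zero_div, zero_mul, one_mul] at hn
  linarith

/-! ### The exponential moment of the current as a renewal quantity -/

open scoped Classical in
/-- `e^{λ J[0,t]}` on the event that exactly `n` flights are completed by time `t`. -/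
def weight (l p t : ℝ) (n : ℕ) (u : ℕ → ℝ) : ENNReal :=
  if flightTime n u ≤ t ∧ t < flightTime (n + 1) u then
    ENNReal.ofReal (Real.exp (flightEnergy l p n u)) else 0

theorem measurable_weight (l p t : ℝ) (n : ℕ) : Measurable (weight l p t n) := by
  unfold weight
  refine Measurable.ite ?_ (by fun_prop) measurable_const
  exact (measurableSet_le (measurable_flightTime n) measurable_const).inter
    (measurableSet_lt measurable_const (measurable_flightTime (n + 1)))

/-- The exponential moment `E e^{λ J[0,t]}` for a particle leaving the wall at time `0`. -/
def partition (βL βR l p t : ℝ) : ENNReal := ∫⁻ u, ∑' n, weight l p t n u ∂speedLaw βL βR p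

theorem flightTime_strictMono {u : ℕ → ℝ} (hu : ∀ k, 0 < u k) :
    StrictMono fun n => flightTime n u := by
  refine strictMono_nat_of_lt_succ fun n => ?_
  have := hu n
  simp only [flightTime, Finset.sum_range_succ, lt_add_iff_pos_right]
  positivity

/-- Exactly one `m` satisfies `flightTime m ≤ t - S_0 < flightTime (m + 1)`, and the terms of
`current` that count are those of index below `m`. The initial data thus enter only through the sign
of `p₀` and a time shift. -/
theorem exp_current_eq_tsum_weight {q₀ p₀ l t : ℝ} (hp : p₀ ≠ 0) {u : ℕ → ℝ}
    (hu : ∀ k, 0 < u k) (hu' : ∀ t : ℝ, ∃ n, t < flightTime n u)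
    (ht : ((Real.sign p₀ + 1) / 2 - q₀) / p₀ ≤ t) :
    ENNReal.ofReal (Real.exp (l * current q₀ p₀ u t)) =
      ∑' n, weight l p₀ (t - ((Real.sign p₀ + 1) / 2 - q₀) / p₀) n u := by
  classical
  set S := ((Real.sign p₀ + 1) / 2 - q₀) / p₀ with hS
  have hmono := flightTime_strictMono hu
  obtain ⟨m, hm1, hm2⟩ : ∃ m, flightTime m u ≤ t - S ∧ t - S < flightTime (m + 1) u := by
    have h0 : Nat.find (hu' (t - S)) ≠ 0 := fun h => by
      have := Nat.find_spec (hu' (t - S))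
      rw [h] at this
      simp [flightTime] at this
      linarith
    obtain ⟨m, hm⟩ := Nat.exists_eq_succ_of_ne_zero h0
    refine ⟨m, not_lt.1 (Nat.find_min (hu' (t - S)) (by omega)), ?_⟩
    have := Nat.find_spec (hu' (t - S))
    rwa [hm] at this
  have hle : ∀ k, flightTime k u ≤ t - S ↔ k ≤ m := by
    intro k
    constructor
    · intro h
      exact Nat.lt_succ_iff.1 (hmono.lt_iff_lt.1 (h.trans_lt hm2))
    · intro h
      exact (hmono.monotone h).trans hm1
  rw [tsum_eq_single m]
  · rw [weight, if_pos ⟨hm1, hm2⟩, current, flightEnergy, tsum_eq_sum (s := Finset.range m)]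
    · congr 2
      rw [← mul_assoc, mul_one_div]
      congr 1
      refine Finset.sum_congr rfl fun k hk => ?_
      have hc : collisionTime q₀ p₀ u (k + 1) ≤ t := by
        have := (hle (k + 1)).2 (Finset.mem_range.1 hk)
        rw [flightTime] at this
        rw [collisionTime]
        linarith
      rw [if_pos hc, mul_pow, wallSign_sq hp, one_mul]
    · intro k hk
      rw [if_neg]
      intro hc
      refine hk (Finset.mem_range.2 ((hle (k + 1)).1 ?_))
      rw [collisionTime] at hc
      rw [flightTime]
      linarith
  · intro k hk
    rw [weight, if_neg]
    rintro ⟨h1, h2⟩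
    have h3 := (hle k).1 h1
    have h4 := (hle (k + 1)).not.1 (not_le.2 h2)
    omega

theorem lintegral_exp_current (hL : 0 < βL) (hR : 0 < βR) {q₀ p₀ l t : ℝ} (hp : p₀ ≠ 0)
    (ht : ((Real.sign p₀ + 1) / 2 - q₀) / p₀ ≤ t) :
    ∫⁻ u, ENNReal.ofReal (Real.exp (l * current q₀ p₀ u t)) ∂speedLaw βL βR p₀ =
      partition βL βR l p₀ (t - ((Real.sign p₀ + 1) / 2 - q₀) / p₀) := by
  refine lintegral_congr_ae ?_
  filter_upwards [ae_pos_speedLaw hL hR p₀, ae_exists_lt_flightTime hL hR hp] with u h1 h2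
  exact exp_current_eq_tsum_weight hp h1 h2 ht

/-! ### Exponential upper and lower bounds -/

/-- Chernoff bound: finiteness of the transform forces `θ ≥ 0`, so `flightTime n ≤ t` gives `1 ≤
e^{θ t - θ flightTime n}`. -/
theorem exists_partition_le (hL : 0 < βL) (hR : 0 < βR) {l θ p : ℝ} (hp : p ≠ 0)
    (h : cycleMass βL βR l θ < 1) :
    ∃ C : ENNReal, C ≠ ⊤ ∧ ∀ t, partition βL βR l p t ≤ C * ENNReal.ofReal (Real.exp (θ * t)) := by
  have hθ := (bounds_of_cycleMass_ne_top hL hR (h.trans ENNReal.one_lt_top).ne).2.2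
  refine ⟨_, tsum_lintegral_exp_flight_ne_top hL hR hp h, fun t => ?_⟩
  rw [← lintegral_tsum fun n => Measurable.aemeasurable (by fun_prop),
    ← lintegral_mul_const' _ _ ENNReal.ofReal_ne_top]
  refine lintegral_mono fun u => ?_
  rw [← ENNReal.tsum_mul_right]
  refine ENNReal.tsum_le_tsum fun n => ?_
  rw [weight]
  split_ifs with hc
  · rw [← ENNReal.ofReal_mul (Real.exp_pos _).le, ← Real.exp_add]
    refine ENNReal.ofReal_le_ofReal (Real.exp_le_exp.2 ?_)
    have := mul_le_mul_of_nonneg_left hc.1 hθ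
    linarith
  · exact zero_le

theorem weight_consSeq (l p t : ℝ) (n : ℕ) (x : ℝ) (v : ℕ → ℝ) :
    weight l p t (n + 1) (consSeq x v) =
      ENNReal.ofReal (Real.exp (l / 2 * (x ^ 2 * -Real.sign p))) *
        weight l (-p) (t - 1 / x) n v := by
  rw [weight, weight, flightTime_consSeq, flightTime_consSeq, flightEnergy_consSeq]
  simp only [le_sub_iff_add_le, sub_lt_iff_lt_add]
  split_ifs
  · rw [← ENNReal.ofReal_mul (Real.exp_pos _).le, ← Real.exp_add, add_comm]
  · simp

/-- The renewal inequality: the event of no completed flight is dropped and the rest is conditioned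
on the first flight. -/
theorem lintegral_partition_le (hL : 0 < βL) (hR : 0 < βR) (l p t : ℝ) :
    ∫⁻ x, ENNReal.ofReal (Real.exp (l / 2 * (x ^ 2 * -Real.sign p))) *
      partition βL βR l (-p) (t - 1 / x) ∂emissionLaw βL βR p ≤ partition βL βR l p t := by
  rw [partition, lintegral_speedLaw hL hR p (Measurable.tsum (measurable_weight l p t))]
  refine lintegral_mono fun x => ?_
  rw [partition, ← lintegral_const_mul' _ _ ENNReal.ofReal_ne_top]
  refine lintegral_mono fun v => ?_
  rw [← ENNReal.tsum_mul_left]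
  simp only [← weight_consSeq]
  exact ENNReal.tsum_comp_le_tsum_of_injective (add_left_injective 1)
    fun n => weight l p t n (consSeq x v)

/-- A first flight longer than `m` completes nothing up to time `t ≤ m`, so the weight is 1. This
seeds the induction for the lower bound. -/
theorem emissionLaw_le_partition (hL : 0 < βL) (hR : 0 < βR) (l p : ℝ) {t m : ℝ}
    (hm : 0 < m) (h0 : 0 ≤ t) (ht : t ≤ m) :
    emissionLaw βL βR p (Set.Ioo 0 (1 / m)) ≤ partition βL βR l p t := by
  have := isProbabilityMeasure_speedLaw hL hR (-p)
  rw [partition, lintegral_speedLaw hL hR p (Measurable.tsum (measurable_weight l p t)),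
    ← lintegral_indicator_one measurableSet_Ioo]
  refine lintegral_mono fun x => ?_
  by_cases hx : x ∈ Set.Ioo 0 (1 / m)
  · rw [Set.indicator_of_mem hx]
    have h1 : ∀ v, 1 ≤ ∑' n, weight l p t n (consSeq x v) := by
      intro v
      refine le_trans ?_ (ENNReal.le_tsum 0)
      rw [weight, if_pos]
      · simp [flightEnergy]
      · refine ⟨by simpa [flightTime] using h0, ?_⟩
        have : m < 1 / x := (lt_one_div hm hx.1).2 hx.2
        simp only [flightTime, zero_add, Finset.sum_range_one, consSeq]
        linarith
    calc (1 : ENNReal) = ∫⁻ _, 1 ∂speedLaw βL βR (-p) := by simp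
      _ ≤ _ := lintegral_mono h1
  · rw [Set.indicator_of_notMem hx]
    exact zero_le

/-- The exponential moment over one flight, restricted to speeds in `[1/m, m]`. -/
def truncatedFlightMass (βL βR l θ p m : ℝ) : ENNReal :=
  ∫⁻ x in Set.Icc (1 / m) m,
    ENNReal.ofReal (Real.exp (l / 2 * (x ^ 2 * -Real.sign p) - θ * (1 / x))) ∂emissionLaw βL βR p

theorem truncatedFlightMass_ne_top (hL : 0 < βL) (hR : 0 < βR) (l θ p : ℝ) {m : ℝ} (hm : 0 < m) :
    truncatedFlightMass βL βR l θ p m ≠ ⊤ := by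
  have := isProbabilityMeasure_emissionLaw hL hR p
  refine ne_top_of_le_ne_top (b := ∫⁻ _ in Set.Icc (1 / m) m,
    ENNReal.ofReal (Real.exp (|l| / 2 * m ^ 2 + |θ| * m)) ∂emissionLaw βL βR p) ?_
    (setLIntegral_mono' measurableSet_Icc fun x hx => ?_)
  · rw [setLIntegral_const]
    exact ENNReal.mul_ne_top ENNReal.ofReal_ne_top (measure_ne_top _ _)
  · refine ENNReal.ofReal_le_ofReal (Real.exp_le_exp.2 ?_)
    have hx0 : 0 < x := (by positivity : 0 < 1 / m).trans_le hx.1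
    have hx1 : 1 / x ≤ m := by
      rw [one_div_le hx0 hm]
      exact hx.1
    have h1 : l / 2 * (x ^ 2 * -Real.sign p) ≤ |l| / 2 * m ^ 2 := by
      refine (le_abs_self _).trans ?_
      rw [abs_mul, abs_mul, abs_div, abs_two, abs_of_nonneg (sq_nonneg x), abs_neg]
      have hs : |Real.sign p| ≤ 1 := by
        rcases Real.sign_apply_eq p with h | h | h <;> simp [h]
      have hxm : x ^ 2 ≤ m ^ 2 := pow_le_pow_left₀ hx0.le hx.2 2
      calc |l| / 2 * (x ^ 2 * |Real.sign p|) ≤ |l| / 2 * (m ^ 2 * 1) := by gcongr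
        _ = _ := by ring
    have h2 : -(θ * (1 / x)) ≤ |θ| * m := by
      have : 0 ≤ 1 / x := by positivity
      calc -(θ * (1 / x)) = -θ * (1 / x) := by ring
        _ ≤ |θ| * m := mul_le_mul (neg_le_abs θ) hx1 this (abs_nonneg θ)
    linarith

theorem tendsto_truncatedFlightMass (l θ p : ℝ) :
    Tendsto (fun n : ℕ => truncatedFlightMass βL βR l θ p (n + 1)) atTop
      (𝓝 (flightMass βL βR l θ p)) := by
  have hmono : Monotone fun n : ℕ => Set.Icc (1 / ((n : ℝ) + 1)) ((n : ℝ) + 1) := by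
    intro a b hab
    have : (a : ℝ) ≤ b := by exact_mod_cast hab
    exact Set.Icc_subset_Icc (one_div_le_one_div_of_le (by positivity) (by linarith))
      (by linarith)
  have hU : (⋃ n : ℕ, Set.Icc (1 / ((n : ℝ) + 1)) ((n : ℝ) + 1)) = Set.Ioi 0 := by
    ext x
    simp only [Set.mem_iUnion, Set.mem_Icc, Set.mem_Ioi]
    constructor
    · rintro ⟨n, h1, -⟩
      exact (by positivity : (0 : ℝ) < 1 / ((n : ℝ) + 1)).trans_le h1
    · intro hx
      obtain ⟨a, ha⟩ := exists_nat_one_div_lt hx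
      obtain ⟨b, hb⟩ := exists_nat_ge x
      have h1 : (a : ℝ) ≤ max a b := by exact_mod_cast le_max_left a b
      have h2 : (b : ℝ) ≤ max a b := by exact_mod_cast le_max_right a b
      refine ⟨max a b, ?_, by linarith⟩
      exact (one_div_le_one_div_of_le (by positivity) (by linarith)).trans ha.le
  have hfull : flightMass βL βR l θ p = ⨆ n : ℕ, truncatedFlightMass βL βR l θ p (n + 1) := by
    simp only [truncatedFlightMass]
    rw [← setLIntegral_iUnion_of_directed _ hmono.directed_le, hU, flightMass,
      Measure.restrict_eq_self_of_ae_mem]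
    exact wallLaw_Ioi _
  rw [hfull]
  exact tendsto_atTop_iSup fun a b hab => lintegral_mono_set (hmono hab)

theorem mul_truncatedFlightMass_le_partition (hL : 0 < βL) (hR : 0 < βR) {l θ p m t : ℝ}
    (hm : 0 < m) (ht : m ≤ t) {B : ENNReal}
    (hB : ∀ s, 0 ≤ s → s ≤ t - 1 / m →
      B * ENNReal.ofReal (Real.exp (θ * s)) ≤ partition βL βR l (-p) s) :
    B * truncatedFlightMass βL βR l θ p m * ENNReal.ofReal (Real.exp (θ * t)) ≤
      partition βL βR l p t := by
  refine le_trans ?_ (lintegral_partition_le hL hR l p t)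
  refine le_trans ?_ (setLIntegral_le_lintegral (Set.Icc (1 / m) m) _)
  rw [truncatedFlightMass, mul_right_comm, ← lintegral_const_mul _ (by fun_prop)]
  refine setLIntegral_mono' measurableSet_Icc fun x hx => ?_
  have hx0 : 0 < x := (by positivity : 0 < 1 / m).trans_le hx.1
  have hx1 : 1 / x ≤ m := by
    rw [one_div_le hx0 hm]
    exact hx.1
  have hx2 : 1 / m ≤ 1 / x := one_div_le_one_div_of_le hx0 hx.2
  refine le_trans (le_of_eq ?_) (mul_le_mul_right (hB (t - 1 / x) (by linarith) (by linarith)) _)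
  rw [mul_left_comm _ B, mul_assoc B]
  congr 1
  rw [← ENNReal.ofReal_mul (Real.exp_pos _).le, ← ENNReal.ofReal_mul (Real.exp_pos _).le,
    ← Real.exp_add, ← Real.exp_add]
  ring_nf

/-- Truncating speeds to `[1/m, m]` keeps the product of the two flight masses above 1 for large
`m`, makes them finite even when the full ones are not, and keeps flight durations in `[1/m, m]`. A
lower bound on a time interval then extends by `1/m`. -/
theorem exists_le_partition (hL : 0 < βL) (hR : 0 < βR) {l θ p : ℝ} (hp : p ≠ 0)
    (h : 1 < cycleMass βL βR l θ) :
    ∃ c : ENNReal, c ≠ 0 ∧ ∀ t, 0 ≤ t →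
      c * ENNReal.ofReal (Real.exp (θ * t)) ≤ partition βL βR l p t := by
  rw [← flightMass_mul hL hR l θ hp] at h
  have hlim := ENNReal.Tendsto.mul (tendsto_truncatedFlightMass (βL := βL) (βR := βR) l θ p)
    (Or.inl (flightMass_pos hL hR l θ hp).ne')
    (tendsto_truncatedFlightMass (βL := βL) (βR := βR) l θ (-p))
    (Or.inl (flightMass_pos hL hR l θ (neg_ne_zero.2 hp)).ne')
  obtain ⟨n, hn⟩ := (hlim.eventually (lt_mem_nhds h)).exists
  set m : ℝ := (n : ℝ) + 1 with hmdef
  have hm : 0 < m := by positivity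
  set x := truncatedFlightMass βL βR l θ p m with hx
  set y := truncatedFlightMass βL βR l θ (-p) m with hy
  have hxf : x ≠ ⊤ := truncatedFlightMass_ne_top hL hR l θ p hm
  have hx0 : x ≠ 0 := fun h => by simp [h] at hn
  set E := ENNReal.ofReal (Real.exp (|θ| * m)) with hE
  have hE0 : E ≠ 0 := by simpa [hE] using Real.exp_pos _
  have hEf : E ≠ ⊤ := ENNReal.ofReal_ne_top
  set w := min (emissionLaw βL βR p (Set.Ioo 0 (1 / m)))
    (emissionLaw βL βR (-p) (Set.Ioo 0 (1 / m))) with hw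
  have hw0 : w ≠ 0 := (lt_min (wallLaw_Ioo_pos (wallBeta_pos hL hR _) (by positivity))
    (wallLaw_Ioo_pos (wallBeta_pos hL hR _) (by positivity))).ne'
  -- Small enough that both `c * x * e^{θ t}` and `c * e^{θ t}` are at most `w` for `0 ≤ t ≤ m`.
  set c := w / ((1 + x) * E) with hc
  have hcw : c * ((1 + x) * E) ≤ w :=
    (ENNReal.div_mul_cancel (mul_ne_zero (by simp) hE0)
      (ENNReal.mul_ne_top (by simpa using hxf) hEf)).le
  have hc0 : c ≠ 0 := by
    refine (ENNReal.div_pos hw0 (ENNReal.mul_ne_top ?_ hEf)).ne'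
    simpa using hxf
  have hbase : ∀ t, 0 ≤ t → t ≤ m → ENNReal.ofReal (Real.exp (θ * t)) ≤ E := by
    intro t h0 h1
    refine ENNReal.ofReal_le_ofReal (Real.exp_le_exp.2 ?_)
    exact mul_le_mul (le_abs_self θ) h1 h0 (abs_nonneg θ)
  -- The constants are `c x` at one wall and `c` at the other: a flight from `p` multiplies `c` by
  -- `x`, one from `-p` turns `c x` into `c x y ≥ c`.
  have key : ∀ k : ℕ, ∀ t, 0 ≤ t → t ≤ m + k * (1 / m) →
      c * x * ENNReal.ofReal (Real.exp (θ * t)) ≤ partition βL βR l p t ∧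
      c * ENNReal.ofReal (Real.exp (θ * t)) ≤ partition βL βR l (-p) t := by
    intro k
    induction k with
    | zero =>
      intro t h0 h1
      have h1 : t ≤ m := by simpa using h1
      constructor
      · refine le_trans ?_ ((hcw.trans (min_le_left _ _)).trans
          (emissionLaw_le_partition hL hR l p hm h0 h1))
        rw [mul_assoc]
        gcongr
        · exact le_add_self
        · exact hbase t h0 h1
      · refine le_trans ?_ ((hcw.trans (min_le_right _ _)).trans
          (emissionLaw_le_partition hL hR l (-p) hm h0 h1))
        gcongr
        refine (hbase t h0 h1).trans ?_
        rw [add_mul, one_mul]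
        exact le_self_add
    | succ k ih =>
      intro t h0 h1
      rcases le_or_gt t m with htm | htm
      · refine ih t h0 (htm.trans ?_)
        have : 0 ≤ (k : ℝ) * (1 / m) := by positivity
        linarith
      · have hs : ∀ s, s ≤ t - 1 / m → s ≤ m + k * (1 / m) := by
          intro s hs
          push_cast at h1
          linarith
        constructor
        · exact mul_truncatedFlightMass_le_partition hL hR hm htm.le
            fun s hs0 hs1 => (ih s hs0 (hs s hs1)).2
        · refine le_trans ?_ (mul_truncatedFlightMass_le_partition hL hR (p := -p) (θ := θ)
            (B := c * x) hm htm.le fun s hs0 hs1 => ?_)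
          · gcongr
            calc c = c * 1 := (mul_one c).symm
              _ ≤ c * (x * y) := by gcongr
              _ = _ := by ring
          · rw [neg_neg]
            exact (ih s hs0 (hs s hs1)).1
  refine ⟨c * x, mul_ne_zero hc0 hx0, fun t h0 => ?_⟩
  obtain ⟨k, hk⟩ := exists_nat_ge (t * m)
  refine (key k t h0 ?_).1
  have : t ≤ k * (1 / m) := by
    rw [mul_one_div, le_div_iff₀ hm]
    exact hk
  linarith

/-! ### Identification of the limit and of its Legendre transform -/

theorem tendsto_affine_div (a b θ : ℝ) :
    Tendsto (fun t : ℝ => 1 / t * (a + θ * (t - b))) atTop (𝓝 θ) := by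
  have h : Tendsto (fun t : ℝ => t⁻¹ * (a - θ * b) + θ) atTop (𝓝 (0 * (a - θ * b) + θ)) :=
    (tendsto_inv_atTop_zero.mul_const _).add_const θ
  rw [zero_mul, zero_add] at h
  refine h.congr' ?_
  filter_upwards [eventually_gt_atTop 0] with t ht
  field_simp
  ring

theorem log_mul_exp_eq {c t θ s : ℝ} (hc : 0 < c) :
    ((1 / t : ℝ) : EReal) * ENNReal.log (ENNReal.ofReal c * ENNReal.ofReal (Real.exp (θ * s))) =
      ((1 / t * (Real.log c + θ * s) : ℝ) : EReal) := by
  rw [← ENNReal.ofReal_mul hc.le, ENNReal.log_ofReal_of_pos (by positivity),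
    Real.log_mul hc.ne' (Real.exp_pos _).ne', Real.log_exp, EReal.coe_mul]

theorem eventually_le_scaledLogMgf (hL : 0 < βL) (hR : 0 < βR) {l θ p₀ : ℝ} (q₀ : ℝ)
    (hp : p₀ ≠ 0) (h : 1 < cycleMass βL βR l θ) {a : ℝ} (ha : a < θ) :
    ∀ᶠ t in atTop, (a : EReal) ≤ scaledLogMgf βL βR q₀ p₀ l t := by
  obtain ⟨c, hc0, hc⟩ := exists_le_partition hL hR hp h
  set S := ((Real.sign p₀ + 1) / 2 - q₀) / p₀ with hS
  -- The constant `c` may be `⊤`; capping it at 1 gives a real logarithm.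
  have hcf : min c 1 ≠ ⊤ := ne_top_of_le_ne_top ENNReal.one_ne_top (min_le_right _ _)
  have hcpos : 0 < (min c 1).toReal :=
    ENNReal.toReal_pos (lt_min (pos_iff_ne_zero.2 hc0) one_pos).ne' hcf
  filter_upwards [(tendsto_affine_div (Real.log (min c 1).toReal) S θ).eventually
    (lt_mem_nhds ha), eventually_gt_atTop 0, eventually_ge_atTop S] with t h1 h2 h3
  rw [scaledLogMgf, lintegral_exp_current hL hR hp h3]
  have h4 := hc (t - S) (by linarith)
  have h5 : ENNReal.ofReal (min c 1).toReal ≤ c := by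
    rw [ENNReal.ofReal_toReal hcf]
    exact min_le_left _ _
  have h6 := (mul_le_mul_left h5 _).trans h4
  calc (a : EReal) ≤ ((1 / t * (Real.log (min c 1).toReal + θ * (t - S)) : ℝ) : EReal) :=
        EReal.coe_le_coe_iff.2 h1.le
    _ = _ := (log_mul_exp_eq hcpos).symm
    _ ≤ _ := mul_le_mul_of_nonneg_left (ENNReal.log_monotone h6)
      (EReal.coe_nonneg.2 (by positivity))

theorem eventually_scaledLogMgf_le (hL : 0 < βL) (hR : 0 < βR) {l θ p₀ : ℝ} (q₀ : ℝ)
    (hp : p₀ ≠ 0) (h : cycleMass βL βR l θ < 1) {a : ℝ} (ha : θ < a) :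
    ∀ᶠ t in atTop, scaledLogMgf βL βR q₀ p₀ l t ≤ (a : EReal) := by
  obtain ⟨C, hCf, hC⟩ := exists_partition_le hL hR hp h
  set S := ((Real.sign p₀ + 1) / 2 - q₀) / p₀ with hS
  have hCpos : 0 < C.toReal + 1 := by positivity
  filter_upwards [(tendsto_affine_div (Real.log (C.toReal + 1)) S θ).eventually
    (gt_mem_nhds ha), eventually_gt_atTop 0, eventually_ge_atTop S] with t h1 h2 h3
  rw [scaledLogMgf, lintegral_exp_current hL hR hp h3]
  have h4 := hC (t - S)
  have h5 : C ≤ ENNReal.ofReal (C.toReal + 1) := by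
    rw [← ENNReal.ofReal_toReal hCf]
    refine ENNReal.ofReal_le_ofReal ?_
    simp
  have h6 := h4.trans (mul_le_mul_left h5 _)
  calc _ ≤ _ := mul_le_mul_of_nonneg_left (ENNReal.log_monotone h6)
        (EReal.coe_nonneg.2 (by positivity))
    _ = ((1 / t * (Real.log (C.toReal + 1) + θ * (t - S)) : ℝ) : EReal) := log_mul_exp_eq hCpos
    _ ≤ (a : EReal) := EReal.coe_le_coe_iff.2 h1.le

/-- The lower envelope `λ ↦ inf {θ : E e^{λ ΔJ - θ Δt} ≤ 1}` of the epigraph. -/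
def envelope (βL βR l : ℝ) : EReal := ⨅ (r : ℝ) (_ : (l, r) ∈ epigraph βL βR), (r : EReal)

theorem mem_epigraph_of_le (hL : 0 < βL) (hR : 0 < βR) {l r r' : ℝ}
    (h : (l, r) ∈ epigraph βL βR) (hr : r ≤ r') : (l, r') ∈ epigraph βL βR := by
  rcases hr.eq_or_lt with rfl | hr
  · exact h
  · exact (cycleMass_strictAnti hL hR hr (ne_top_of_le_ne_top ENNReal.one_ne_top h)).le.trans h

/-- The region is closed and stable under increasing `θ`, so the infimum is attained when finite. -/
theorem envelope_le_iff (hL : 0 < βL) (hR : 0 < βR) {l θ : ℝ} :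
    envelope βL βR l ≤ θ ↔ (l, θ) ∈ epigraph βL βR := by
  refine ⟨fun h => ?_, fun h => iInf₂_le θ h⟩
  have hsub : Set.Ioi θ ⊆ {r | (l, r) ∈ epigraph βL βR} := by
    intro r hr
    have hlt : envelope βL βR l < r := h.trans_lt (EReal.coe_lt_coe_iff.2 hr)
    obtain ⟨r', hr', hlt'⟩ := by simpa only [envelope, iInf_lt_iff] using hlt
    exact mem_epigraph_of_le hL hR hr' (EReal.coe_lt_coe_iff.1 hlt').le
  have hclosed : IsClosed {r : ℝ | (l, r) ∈ epigraph βL βR} :=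
    (isClosed_epigraph hL hR).preimage (by fun_prop : Continuous fun r : ℝ => (l, r))
  have := closure_minimal hsub hclosed
  rw [closure_Ioi] at this
  exact this (Set.mem_Ici.2 le_rfl)

theorem envelope_nonneg (hL : 0 < βL) (hR : 0 < βR) (l : ℝ) : 0 ≤ envelope βL βR l :=
  le_iInf₂ fun _ hr => EReal.coe_nonneg.2 (bounds_of_mem_epigraph hL hR hr).2.2

theorem tendsto_scaledLogMgf (hL : 0 < βL) (hR : 0 < βR) (q₀ : ℝ) {p₀ : ℝ} (hp : p₀ ≠ 0) (l : ℝ) :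
    Tendsto (scaledLogMgf βL βR q₀ p₀ l) atTop (𝓝 (envelope βL βR l)) := by
  refine tendsto_order.2 ⟨fun a ha => ?_, fun b hb => ?_⟩
  · obtain ⟨r, har, hr⟩ := EReal.lt_iff_exists_real_btwn.1 ha
    obtain ⟨r', har', hr'⟩ := EReal.lt_iff_exists_real_btwn.1 har
    have h1 : 1 < cycleMass βL βR l r :=
      not_le.1 fun h => not_le.2 hr ((envelope_le_iff hL hR).2 h)
    filter_upwards [eventually_le_scaledLogMgf hL hR q₀ hp h1 (EReal.coe_lt_coe_iff.1 hr')]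
      with t ht
    exact har'.trans_le ht
  · obtain ⟨r, hr, hrb⟩ := EReal.lt_iff_exists_real_btwn.1 hb
    obtain ⟨r₁, hr₁, hrb₁⟩ := EReal.lt_iff_exists_real_btwn.1 hrb
    obtain ⟨r₂, hr₂, hrb₂⟩ := EReal.lt_iff_exists_real_btwn.1 hrb₁
    have h1 : cycleMass βL βR l r ≤ 1 := (envelope_le_iff hL hR).1 hr.le
    -- Strict monotonicity in `θ` upgrades `≤ 1` at `r` to `< 1` at `r₁`, as the Chernoff bound
    -- requires.
    have h2 := (cycleMass_strictAnti hL hR (EReal.coe_lt_coe_iff.1 hr₁)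
      (ne_top_of_le_ne_top ENNReal.one_ne_top h1)).trans_le h1
    filter_upwards [eventually_scaledLogMgf_le hL hR q₀ hp h2 (EReal.coe_lt_coe_iff.1 hr₂)]
      with t ht
    exact ht.trans_lt hrb₂

theorem cgf_eq_envelope (hL : 0 < βL) (hR : 0 < βR) (q₀ : ℝ) {p₀ : ℝ} (hp : p₀ ≠ 0) (l : ℝ) :
    cgf βL βR q₀ p₀ l = envelope βL βR l :=
  (tendsto_scaledLogMgf hL hR q₀ hp l).limsup_eq

/-- For fixed `λ` the best `θ` is the envelope, so both suprema agree; a `λ` with infinite envelope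
contributes `⊥`. -/
theorem rateFunction_eq_rate (hL : 0 < βL) (hR : 0 < βR) (q₀ : ℝ) {p₀ : ℝ} (hp : p₀ ≠ 0) (j : ℝ) :
    rateFunction βL βR q₀ p₀ j = (rate βL βR j : EReal) := by
  simp only [rateFunction, cgf_eq_envelope hL hR q₀ hp]
  refine le_antisymm (iSup_le fun l => ?_) ?_
  · have hnn := envelope_nonneg hL hR l
    induction h : envelope βL βR l with
    | bot => simp [h] at hnn
    | top => simp
    | coe c =>
      have := le_rate hL hR ((envelope_le_iff hL hR).1 h.le) j
      exact_mod_cast this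
  · obtain ⟨q, hq, hmax⟩ := exists_isMaxOn_epigraph hL hR j
    rw [rate_eq_of_isMaxOn hq hmax]
    refine le_trans ?_ (le_iSup (fun l : ℝ => ((l * j : ℝ) : EReal) - envelope βL βR l) q.1)
    rw [EReal.coe_sub]
    exact EReal.sub_le_sub le_rfl ((envelope_le_iff hL hR).2 hq)

end

end ConfinedTracer

open ConfinedTracer in
theorem mainTheorem4 (βL βR : ℝ) (hL : 0 < βL) (hLR : βL ≤ βR)
    (q₀ p₀ : ℝ) (hq₀ : q₀ ∈ Set.Icc (0 : ℝ) 1) (hp₀ : p₀ ≠ 0) :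
    -- the limit defining the cumulant generating function exists in the extended reals, and
    -- it does not depend on the initial data
    (∀ l : ℝ, Tendsto (scaledLogMgf βL βR q₀ p₀ l) atTop (𝓝 (cgf βL βR q₀ p₀ l))) ∧
    (∀ q₁ ∈ Set.Icc (0 : ℝ) 1, ∀ p₁ : ℝ, p₁ ≠ 0 →
      ∀ l : ℝ, cgf βL βR q₁ p₁ l = cgf βL βR q₀ p₀ l) ∧
    -- the Legendre transform is finite, that is, given by a real-valued function
    ∃ I : ℝ → ℝ, (∀ j : ℝ, rateFunction βL βR q₀ p₀ j = (I j : EReal)) ∧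
      (∀ j : ℝ, 0 ≤ I j) ∧
      ConvexOn ℝ Set.univ I ∧
      -- smooth and strictly convex outside `[-j*, j*]`
      ContDiffOn ℝ (⊤ : ℕ∞) I (Set.Icc (-jStar βL βR) (jStar βL βR))ᶜ ∧
      (∀ x ∈ (Set.Icc (-jStar βL βR) (jStar βL βR))ᶜ,
        ∀ y ∈ (Set.Icc (-jStar βL βR) (jStar βL βR))ᶜ, x ≠ y →
        ∀ a b : ℝ, 0 < a → 0 < b → a + b = 1 → I (a * x + b * y) < a * I x + b * I y) ∧
      (∀ j ∈ Set.Icc 0 (jStar βL βR), I j = 0) ∧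
      (∀ j ∈ Set.Icc (-jStar βL βR) 0, I j = (βR - βL) * |j|) ∧
      (∀ j : ℝ, I j = (βL - βR) * j + I (-j)) := by
  have hR := hL.trans_le hLR
  refine ⟨fun l => ?_, fun q₁ _ p₁ hp₁ l => ?_, rate βL βR, rateFunction_eq_rate hL hR q₀ hp₀,
    rate_nonneg hL hR, convexOn_rate hL hR, contDiffOn_rate hL hLR,
    fun x hx y hy hxy a b ha hb hab => rate_lt hL hLR hxy hx hy ha hb hab,
    fun j hj => rate_eq_zero hL hR hj, fun j hj => ?_, rate_reflect hL hR⟩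
  · rw [cgf_eq_envelope hL hR q₀ hp₀]
    exact tendsto_scaledLogMgf hL hR q₀ hp₀ l
  · rw [cgf_eq_envelope hL hR q₁ hp₁, cgf_eq_envelope hL hR q₀ hp₀]
  -- Item 3 is the symmetry 4 combined with the vanishing of the rate at `-j ∈ [0, j*]`.
  · rw [rate_reflect hL hR j, rate_eq_zero hL hR (j := -j) ⟨by linarith [hj.2], by linarith [hj.1]⟩,
      abs_of_nonpos hj.2]
    ring
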